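/- **Setting.** Let $\mathcal X$ be a finite nonempty set of arms, $\mathcal H$ a real Hilbert space, $\phi:\mathcal X\to\mathcal H$ a feature map, $\gamma>0$, $\sigma\ge 0$, $\delta\in(0,1)$. For a probability vector $\lambda$ on $\mathcal X$ put $A(\lambda)=\sum_x\lambda_x\phi(x)\phi(x)^\top$, and write $\|v\|^2_{M^{-1}}=\langle v,M^{-1}v\rangle$. Let $\triangle_{\mathcal V}$ be the probability vectors supported on $\mathcal V\subseteq\mathcal X$, $f(\lambda,\mathcal V,\gamma)=\max_{v\in\mathcal V}\|\phi(v)\|^2_{(A(\lambda)+\gamma I)^{-1}}$ and $f(\mathcal V,\gamma)=\inf_{\lambda\in\triangle_{\mathcal V}}f(\lambda,\mathcal V,\gamma)$. Let $\widetilde d(\gamma,\lambda)$ be the number (with multiplicity) of eigenvalues of $A(\lambda)$ that are at least $\gamma$. **Algorithm (PTR for regret minimization, with constant $\kappa$).** Start with $\mathcal X_1=\mathcal X$. In stage $\ell=1,2,\dots$, while $|\mathcal X_\ell|>1$: let $\lambda_\ell\in\triangle_{\mathcal X_\ell}$ minimize $f(\cdot,\mathcal X_\ell,\gamma)$, let $\epsilon_\ell=2^{-\ell}$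 and $$\tau_\ell=\max\Big\{1,\Big\lceil\max\big\{2\sigma^2\epsilon_\ell^{-2}f(\mathcal X_\ell,\gamma)\log(4\ell^2|\mathcal X|/\delta),\ \kappa\,\widetilde d(\gamma,\lambda_\ell)\big\}\Big\rceil\Big\};$$ take a project-then-round (PTR) allocation $\widetilde x_1,\dots,\widetilde x_{\tau_\ell}\in\mathcal X_\ell$ of $\lambda_\ell$, play it, observe the rewards $Y$, compute the regularized least squares estimate $\widehat\theta_\ell=(\Phi^\top\Phi+\tau_\ell\gamma I)^{-1}\Phi^\top Y$, where $\Phi$ has the rows $\phi(\widetilde x_i)^\top$, and set $\mathcal X_{\ell+1}=\{x\in\mathcal X_\ell:\max_{x'\in\mathcal X_\ell}\langle\phi(x')-\phi(x),\widehat\theta_\ell\rangle<8\epsilon_\ell\}$. When one arm is left, play it forever. The design depends only on $\mathcal X_\ell$, and the allocation only on $(\ell,\mathcal X_\ell)$. Here $\widetilde x_1,\dots,\widetilde x_\tau\in\mathcal V$ is a *PTR allocation* of $\lambda\in\triangle_{\mathcal V}$ if it rounds $\lambda$ up to a factor $4$ * after projection: $\tau\sum_x\lambda_x\langle\phi(x),z\rangle^2+\tau\gamma\|z\|^2\le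 4\big(\sum_{i\le\tau}\langle\phi(\widetilde x_i),z\rangle^2+\tau\gamma\|z\|^2\big)$ for all $z$ in the span of the eigenvectors of $A(\lambda)$ with eigenvalue $\ge\gamma$; and * for the worst-case variance: $\max_{v\in\mathcal V}\|\phi(v)\|^2_{(\sum_{i\le\tau}\phi(\widetilde x_i)\phi(\widetilde x_i)^\top+\tau\gamma I)^{-1}}\le 4\max_{v\in\mathcal V}\|\phi(v)\|^2_{(\tau A(\lambda)+\tau\gamma I)^{-1}}$. **Theorem.** There is an absolute constant $\kappa_0\ge1$ such that for every $\kappa\ge\kappa_0$ there is a constant $c>0$, depending only on $\kappa$, with the following property, for all $\mathcal X,\mathcal H,\phi,\gamma,\sigma,\delta$ as above. 1. The algorithm can be carried out: the minimizing designs exist, and so do PTR allocations of the prescribed lengths, for every stage and every active set with more than one arm. 2. Consider any version of the algorithm, i.e. any choice of minimizing designs and PTR allocations. Let the reward of the arm $x_t$ played at time $t$ be $y_t=\mu_{x_t}+\xi_t$ with independent, mean-zero, $\sigma^2$-sub-Gaussian noise $\xi_t$, where $\max_x|\mu_x|\le B$ and $\max_x|\mu_x-\langle\theta_*,\phi(x)\rangle|\le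 h$ for some $\theta_*\in\mathcal H$ and $h\ge0$; if $h>0$, suppose that $\gamma\le\max_x\|\phi(x)\|^2$. Let $T\ge2$. Then with probability at least $1-\delta$ $$\max_{x\in\mathcal X}\sum_{t=1}^T(\mu_x-\mu_{x_t})\le c\max\{1,B\}\Big(\widetilde d(\gamma)+\sqrt{\max_{\emptyset\ne\mathcal V\subseteq\mathcal X}f(\mathcal V,\gamma)}\,\Big(T(\sqrt\gamma\,\|\theta_*\|+h)+\sqrt{\sigma^2T\log(|\mathcal X|\log(T)/\delta)}\Big)\Big),$$ where $\widetilde d(\gamma)$ is the maximum of $\widetilde d(\gamma,\lambda_\ell)$ over the elimination stages entered during the first $T$ plays ($0$ if there are none), and always $\widetilde d(\gamma)\le\max_{\emptyset\ne\mathcal V\subseteq\mathcal X}\sup_{\lambda\in\triangle_{\mathcal V}}\widetilde d(\gamma,\lambda)$. (A square root of a negative number, which can occur only when $|\mathcal X|=1$, is read as $0$.) -/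

import Mathlib

open scoped InnerProductSpace

noncomputable section

namespace PTRBandit

section Design

variable {α : Type*} [Fintype α] {H : Type*} [NormedAddCommGroup H] [InnerProductSpace ℝ H]

/-- The design operator `A(lam) = ∑ x, lam x • φ(x) φ(x)ᵀ` on the feature space. -/
def designOp (φ : α → H) (lam : α → ℝ) : H →L[ℝ] H :=
  ∑ x, lam x • InnerProductSpace.rankOne ℝ (φ x) (φ x)

/-- The unnormalised operator `Φᵀ Φ = ∑ i < τ, φ(a i) φ(a i)ᵀ` of a sequence of `τ` measurements. -/
def sampleOp (φ : α → H) (a : ℕ → α) (τ : ℕ) : H →L[ℝ] H :=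
  ∑ i ∈ Finset.range τ, InnerProductSpace.rankOne ℝ (φ (a i)) (φ (a i))

/-- `‖v‖²` in the metric of `(S + r I)⁻¹`, that is `vᵀ (S + r I)⁻¹ v`. It is used for positive
semidefinite `S` and `r > 0` only, where `S + r I` is invertible. -/
def invNormSq (S : H →L[ℝ] H) (r : ℝ) (v : H) : ℝ :=
  ⟪v, Ring.inverse (S + r • (1 : H →L[ℝ] H)) v⟫_ℝ

/-- The probability simplex over the arms in `V`. -/
def simplex (V : Finset α) : Set (α → ℝ) :=
  {lam | (∀ x, 0 ≤ lam x) ∧ (∀ x, x ∉ V → lam x = 0) ∧ ∑ x, lam x = 1}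

/-- `f(lam, V, γ) = max_{v ∈ V} ‖φ(v)‖²` in the metric of `(A(lam) + γ I)⁻¹`. -/
def designValue (φ : α → H) (γ : ℝ) (V : Finset α) (lam : α → ℝ) : ℝ :=
  ⨆ v : V, invNormSq (designOp φ lam) γ (φ v)

/-- `f(V, γ)`, the infimum of `f(lam, V, γ)` over the designs `lam` on `V`. -/
def optValue (φ : α → H) (γ : ℝ) (V : Finset α) : ℝ :=
  ⨅ lam : simplex V, designValue φ γ V lam

/-- `max_{V ⊆ X} f(V, γ)`, over the nonempty sets of arms. -/
def maxOptValue (φ : α → H) (γ : ℝ) : ℝ :=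
  ⨆ V : {V : Finset α // V.Nonempty}, optValue φ γ V

/-- The span of the eigenvectors of `A(lam)` whose eigenvalue is at least `γ`. -/
def topSpace (φ : α → H) (γ : ℝ) (lam : α → ℝ) : Submodule ℝ H :=
  ⨆ s : {s : ℝ // γ ≤ s}, Module.End.eigenspace (designOp φ lam : H →ₗ[ℝ] H) (s : ℝ)

/-- The effective dimension: the number, with multiplicity, of the eigenvalues of `A(lam)` that are
at least `γ`, i.e. `max {i : d_i ≥ γ}` for the ordered eigenvalues `d_1 ≥ d_2 ≥ …`. (For `γ > 0` it
does not matter whether `A(lam)` is formed from `φ` or from the rows of a square factor of the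
kernel matrix, since the nonzero eigenvalues agree.) -/
def effDim (φ : α → H) (γ : ℝ) (lam : α → ℝ) : ℕ :=
  Module.finrank ℝ (topSpace φ γ lam)

/-- `max_{V ⊆ X} sup_{lam} effDim(γ, lam)`, over nonempty `V` and designs `lam` on `V`. -/
def maxEffDim (φ : α → H) (γ : ℝ) : ℕ :=
  ⨆ V : {V : Finset α // V.Nonempty}, ⨆ lam : simplex (V : Finset α), effDim φ γ lam

end Design

section Algorithm

variable {α : Type*} [Fintype α] {H : Type*} [NormedAddCommGroup H] [InnerProductSpace ℝ H]

/-- `ε_ℓ = 2^{-ℓ}`. -/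
def eps (ℓ : ℕ) : ℝ := (1 / 2 : ℝ) ^ ℓ

/-- The number `τ_ℓ` of measurements of stage `ℓ` when the active set is `V` and the design is
`lam`; at least one measurement is taken. The natural number ceiling is harmless, as the argument
is nonnegative. -/
def stageLength (φ : α → H) (γ σ δ κ : ℝ) (ℓ : ℕ) (V : Finset α) (lam : α → ℝ) : ℕ :=
  max 1 ⌈max (2 * σ ^ 2 * (eps ℓ)⁻¹ ^ 2 * optValue φ γ V *
      Real.log (4 * (ℓ : ℝ) ^ 2 * Fintype.card α / δ)) (κ * effDim φ γ lam)⌉₊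

/-- The choices left open by the description of the algorithm: which minimising design is used for
an active set, and which allocation (as a sequence of arms, of which the first `τ_ℓ` are played)
the rounding step returns in stage `ℓ` for an active set. They do not see the rewards. -/
structure Rule (α : Type*) where
  design : Finset α → α → ℝ
  alloc : ℕ → Finset α → ℕ → α

/-- Length of stage `ℓ` on the active set `V` when the choices are made by `R`. -/
def Rule.len (R : Rule α) (φ : α → H) (γ σ δ κ : ℝ) (ℓ : ℕ) (V : Finset α) : ℕ :=
  stageLength φ γ σ δ κ ℓ V (R.design V)

/-- The allocation `a` of `τ` measurements is a project-then-round allocation for the design `lam`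
on `V`: it uses arms of `V`; after projection to the top eigenspace of `A(lam)` it rounds the design
up to a constant factor (the order of quadratic forms on that space); and it is a rounding of the
design up to the same factor for the worst-case variance over `V` in the whole feature space. -/
structure IsPTRAllocation (φ : α → H) (γ : ℝ) (V : Finset α) (lam : α → ℝ) (τ : ℕ)
    (a : ℕ → α) : Prop where
  mem : ∀ i < τ, a i ∈ V
  projected : ∀ z ∈ topSpace φ γ lam,
    (τ : ℝ) * ∑ x, lam x * ⟪φ x, z⟫_ℝ ^ 2 + τ * γ * ‖z‖ ^ 2 ≤
      4 * (∑ i ∈ Finset.range τ, ⟪φ (a i), z⟫_ℝ ^ 2 + τ * γ * ‖z‖ ^ 2)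
  full : (⨆ v : V, invNormSq (sampleOp φ a τ) (τ * γ) (φ v)) ≤
    4 * ⨆ v : V, invNormSq ((τ : ℝ) • designOp φ lam) (τ * γ) (φ v)

/-- `R` makes admissible choices: on every active set with more than one arm the design minimises
`f(·, V, γ)`, and in every stage `ℓ ≥ 1` the allocation is a project-then-round allocation. -/
structure Rule.IsPTR (R : Rule α) (φ : α → H) (γ σ δ κ : ℝ) : Prop where
  design_mem : ∀ V : Finset α, 1 < V.card → R.design V ∈ simplex V
  design_min : ∀ V : Finset α, 1 < V.card → ∀ lam ∈ simplex V,
    designValue φ γ V (R.design V) ≤ designValue φ γ V lam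
  alloc_ptr : ∀ ℓ : ℕ, 1 ≤ ℓ → ∀ V : Finset α, 1 < V.card →
    IsPTRAllocation φ γ V (R.design V) (R.len φ γ σ δ κ ℓ V) (R.alloc ℓ V)

/-- The regularised least squares estimate `(Φᵀ Φ + τ γ I)⁻¹ Φᵀ Y` from the `τ` measurements
`a 0, …, a (τ - 1)` taken at the times `s, …, s + τ - 1`, with rewards `Y i = μ (a i) + ξ (s + i)`
for the noise sequence `ξ`. -/
def estimate (φ : α → H) (γ : ℝ) (μ : α → ℝ) (ξ : ℕ → ℝ) (a : ℕ → α) (τ s : ℕ) : H :=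
  Ring.inverse (sampleOp φ a τ + (τ * γ : ℝ) • (1 : H →L[ℝ] H))
    (∑ i ∈ Finset.range τ, (μ (a i) + ξ (s + i)) • φ (a i))

open Classical in
/-- The arms of `V` that survive stage `ℓ` with the estimate `θ`. -/
def survivors (φ : α → H) (ℓ : ℕ) (V : Finset α) (θ : H) : Finset α :=
  V.filter fun x => ∀ x' ∈ V, ⟪φ x' - φ x, θ⟫_ℝ < 8 * eps ℓ

open Classical in
/-- `stage j` is the active set and the starting time (times are `0, 1, 2, …`) of stage
`ℓ = j + 1`. Once a single arm is left, every further "stage" is one play of that arm. -/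
def stage (R : Rule α) (φ : α → H) (γ σ δ κ : ℝ) (μ : α → ℝ) (ξ : ℕ → ℝ) :
    ℕ → Finset α × ℕ
  | 0 => (Finset.univ, 0)
  | j + 1 =>
    let V := (stage R φ γ σ δ κ μ ξ j).1
    let s := (stage R φ γ σ δ κ μ ξ j).2
    let τ := R.len φ γ σ δ κ (j + 1) V
    if 1 < V.card then
      (survivors φ (j + 1) V (estimate φ γ μ ξ (R.alloc (j + 1) V) τ s), s + τ)
    else (V, s + 1)

/-- The index of the stage to which time `t` belongs. Starting times increase strictly from `0`, so
this is the last stage that has started by time `t`. -/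
def stageAt (R : Rule α) (φ : α → H) (γ σ δ κ : ℝ) (μ : α → ℝ) (ξ : ℕ → ℝ) (t : ℕ) : ℕ :=
  Nat.findGreatest (fun j => (stage R φ γ σ δ κ μ ξ j).2 ≤ t) t

open Classical in
/-- The arm played at time `t`: the next arm of the allocation of the current stage, or the unique
arm left. -/
def action [Nonempty α] (R : Rule α) (φ : α → H) (γ σ δ κ : ℝ) (μ : α → ℝ) (ξ : ℕ → ℝ)
    (t : ℕ) : α :=
  let j := stageAt R φ γ σ δ κ μ ξ t
  let V := (stage R φ γ σ δ κ μ ξ j).1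
  let s := (stage R φ γ σ δ κ μ ξ j).2
  if 1 < V.card then R.alloc (j + 1) V (t - s)
  else if hV : V.Nonempty then hV.choose else Classical.arbitrary α

/-- The cumulative regret `max_x ∑_{t < T} (μ x - μ x_t)`. -/
def regret [Nonempty α] (R : Rule α) (φ : α → H) (γ σ δ κ : ℝ) (μ : α → ℝ) (ξ : ℕ → ℝ)
    (T : ℕ) : ℝ :=
  ⨆ x : α, ∑ t ∈ Finset.range T, (μ x - μ (action R φ γ σ δ κ μ ξ t))

open Classical in
/-- `max_{ℓ ≤ L} effDim(γ, lam_ℓ)`, over the elimination stages entered during the first `T`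
plays (`0` if there is none). -/
def runEffDim (R : Rule α) (φ : α → H) (γ σ δ κ : ℝ) (μ : α → ℝ) (ξ : ℕ → ℝ) (T : ℕ) : ℕ :=
  (Finset.range T).sup fun t =>
    let V := (stage R φ γ σ δ κ μ ξ (stageAt R φ γ σ δ κ μ ξ t)).1
    if 1 < V.card then effDim φ γ (R.design V) else 0

end Algorithm

end PTRBandit

end

/-! ### Positive definite matrices, leverages and determinant exchange. -/

noncomputable section

namespace PTRBandit

section Matrices

open Matrix

variable {n : Type*} [Fintype n] [DecidableEq n]

/-! Two facts carry the theorem: PTR allocations exist once `τ` is at least 64 times the effective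
dimension, and elimination based on such allocations has small regret.

Existence. In eigencoordinates of `A(λ)` on the finite-dimensional span of the features, the
measurements are split into two halves, one for each requirement. Extra measurements only increase
`ΦᵀΦ`, so the halves do not disturb each other. On the top eigenspace, after rescaling by the square
roots of the eigenvalues, `λ` is isotropic, and a one-sided barrier argument in the style of Batson,
Spielman and Srivastava (`exists_barrier_step`) selects vectors with `∑ v vᵀ ≥ (3t/4 - 4d) I`. For
the worst-case variance one takes the arms that maximise a regularised determinant. If some arm had
too large a leverage, the exchange inequality would force every selected arm to have a large one,
against a trace bound (`exists_selection_inv_quad_le`). The effective dimension enters that trace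
bound only when the variance is not small (`exists_selection_worst_case`).

Regret on the good event. The prediction error of a stage is noise, at most `2ε`, plus a bias of
order `√F (√γ ‖θ‖ + h) + h`, where `F = max f(V, γ)`. While the bias is below `2ε` the best arm
survives and the gaps shrink with `ε`; once it is not, all remaining gaps are of the order of the
bias, and stay so because active sets are nested (`gap_invariant`). A stage of effective dimension
zero has short features, hence gaps of the order of the bias in any case (`gap_le`). In every other
elimination stage the dimension is at least one and absorbs the rounding of `τ`. Summing `τ ε` over
these stages, with a cutoff at the scale `T / (√(T y) + 1)`, where `y = σ² F log(|X| log T / δ)`,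
gives the dimension term and the square root term (`sum_eps_stages_le`).

Probability of the good event. Start and active set of a stage are determined by the earlier noise,
while its own noise sum, for a fixed start and active set, involves later times only. Independence
therefore reduces the claim to deterministic weights, and a sub-Gaussian tail with union bounds over
arms and stages finishes (`measure_noiseBad_le`, `measure_not_noiseSmall_le`). -/

theorem posDef_add_vecMulVec {n : Type*} [Finite n] {M : Matrix n n ℝ} (hM : M.PosDef) (v : n → ℝ) :
    (M + vecMulVec v v).PosDef := by
  have : (vecMulVec v v).PosSemidef := by simpa using posSemidef_vecMulVec_self_star v
  exact hM.add_posSemidef this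

theorem inv_mulVec_dotProduct_comm {M : Matrix n n ℝ} (hM : M.PosDef) (x y : n → ℝ) :
    (M⁻¹ *ᵥ x) ⬝ᵥ y = x ⬝ᵥ (M⁻¹ *ᵥ y) := by
  have h : M⁻¹ᵀ = M⁻¹ := by simpa using hM.inv.isHermitian.eq
  rw [dotProduct_mulVec, ← mulVec_transpose, h]

theorem mulVec_inv_mulVec {M : Matrix n n ℝ} (hM : M.PosDef) (x : n → ℝ) :
    M *ᵥ (M⁻¹ *ᵥ x) = x := by
  rw [mulVec_mulVec, Matrix.mul_nonsing_inv _ ((Matrix.isUnit_iff_isUnit_det _).1 hM.isUnit),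
    one_mulVec]

theorem inv_quad_nonneg {M : Matrix n n ℝ} (hM : M.PosDef) (x : n → ℝ) :
    0 ≤ x ⬝ᵥ (M⁻¹ *ᵥ x) := by
  simpa using hM.inv.posSemidef.dotProduct_mulVec_nonneg x

/-- The Cauchy–Schwarz inequality for a positive definite matrix and its inverse. -/
theorem sq_dotProduct_le_inv_quad_mul_quad {M : Matrix n n ℝ} (hM : M.PosDef) (v z : n → ℝ) :
    (v ⬝ᵥ z) ^ 2 ≤ (v ⬝ᵥ (M⁻¹ *ᵥ v)) * (z ⬝ᵥ (M *ᵥ z)) := by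
  -- The form of `M` at `z - t M⁻¹v` is a nonnegative quadratic polynomial in `t`, so its
  -- discriminant is not positive.
  have key : ∀ t : ℝ, 0 ≤ (v ⬝ᵥ (M⁻¹ *ᵥ v)) * (t * t) + (-2 * (v ⬝ᵥ z)) * t
      + z ⬝ᵥ (M *ᵥ z) := by
    intro t
    have h := hM.posSemidef.dotProduct_mulVec_nonneg (z - t • (M⁻¹ *ᵥ v))
    have hs : (M⁻¹ *ᵥ v) ⬝ᵥ (M *ᵥ z) = v ⬝ᵥ z := by
      have hT : Mᵀ = M := by simpa using hM.isHermitian.eq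
      rw [dotProduct_mulVec, ← mulVec_transpose, hT, mulVec_inv_mulVec hM]
    simp only [star_trivial, mulVec_sub, mulVec_smul, mulVec_inv_mulVec hM, sub_dotProduct,
      dotProduct_sub, smul_dotProduct, dotProduct_smul, hs, smul_eq_mul,
      inv_mulVec_dotProduct_comm hM] at h
    rw [dotProduct_comm z v] at h
    linarith
  have := discrim_le_zero key
  unfold discrim at this
  nlinarith

theorem det_add_vecMulVec {M : Matrix n n ℝ} (hM : M.PosDef) (v : n → ℝ) :
    (M + vecMulVec v v).det = M.det * (1 + v ⬝ᵥ (M⁻¹ *ᵥ v)) := by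
  have h1 : M + vecMulVec v v = M * (1 + vecMulVec (M⁻¹ *ᵥ v) v) := by
    rw [mul_add, mul_one, mul_vecMulVec, mulVec_inv_mulVec hM]
  rw [h1, det_mul, vecMulVec_eq Unit, det_one_add_replicateCol_mul_replicateRow]

/-- The Sherman–Morrison formula. -/
theorem inv_add_vecMulVec {M : Matrix n n ℝ} (hM : M.PosDef) (v : n → ℝ) :
    (M + vecMulVec v v)⁻¹ =
      M⁻¹ - (1 + v ⬝ᵥ (M⁻¹ *ᵥ v))⁻¹ • vecMulVec (M⁻¹ *ᵥ v) (M⁻¹ *ᵥ v) := by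
  have hg : (1 + v ⬝ᵥ (M⁻¹ *ᵥ v)) ≠ 0 := by have := inv_quad_nonneg hM v; positivity
  have hT : M⁻¹ᵀ = M⁻¹ := by simpa using hM.inv.isHermitian.eq
  apply inv_eq_right_inv
  have h1 : vecMulVec v v * M⁻¹ = vecMulVec v (M⁻¹ *ᵥ v) := by
    rw [vecMulVec_mul, ← mulVec_transpose, hT]
  have h2 : vecMulVec v v * vecMulVec (M⁻¹ *ᵥ v) (M⁻¹ *ᵥ v)
      = (v ⬝ᵥ (M⁻¹ *ᵥ v)) • vecMulVec v (M⁻¹ *ᵥ v) := by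
    rw [vecMulVec_mul_vecMulVec, vecMulVec_smul]
  rw [add_mul, mul_sub, mul_sub, Matrix.mul_nonsing_inv _
    ((Matrix.isUnit_iff_isUnit_det _).1 hM.isUnit), h1, Matrix.mul_smul, Matrix.mul_smul,
    mul_vecMulVec, mulVec_inv_mulVec hM, h2]
  refine Matrix.ext fun i j => ?_
  simp only [Matrix.add_apply, Matrix.sub_apply, Matrix.smul_apply, smul_eq_mul]
  field_simp
  ring

theorem inv_quad_add_vecMulVec {M : Matrix n n ℝ} (hM : M.PosDef) (v b : n → ℝ) :
    b ⬝ᵥ ((M + vecMulVec v v)⁻¹ *ᵥ b) =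
      b ⬝ᵥ (M⁻¹ *ᵥ b) - (b ⬝ᵥ (M⁻¹ *ᵥ v)) ^ 2 / (1 + v ⬝ᵥ (M⁻¹ *ᵥ v)) := by
  rw [inv_add_vecMulVec hM, sub_mulVec, smul_mulVec, vecMulVec_mulVec, dotProduct_sub,
    dotProduct_smul]
  simp only [op_smul_eq_smul, dotProduct_smul, smul_eq_mul]
  rw [dotProduct_comm (M⁻¹ *ᵥ v) b]
  ring

theorem inv_quad_add_vecMulVec_le {M : Matrix n n ℝ} (hM : M.PosDef) (v b : n → ℝ) :
    b ⬝ᵥ ((M + vecMulVec v v)⁻¹ *ᵥ b) ≤ b ⬝ᵥ (M⁻¹ *ᵥ b) := by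
  rw [inv_quad_add_vecMulVec hM]
  have := inv_quad_nonneg hM v
  have : 0 ≤ (b ⬝ᵥ (M⁻¹ *ᵥ v)) ^ 2 / (1 + v ⬝ᵥ (M⁻¹ *ᵥ v)) := by positivity
  linarith

theorem inv_quad_add_vecMulVec_self {M : Matrix n n ℝ} (hM : M.PosDef) (v : n → ℝ) :
    v ⬝ᵥ ((M + vecMulVec v v)⁻¹ *ᵥ v) =
      (v ⬝ᵥ (M⁻¹ *ᵥ v)) / (1 + v ⬝ᵥ (M⁻¹ *ᵥ v)) := by
  rw [inv_quad_add_vecMulVec hM]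
  have := inv_quad_nonneg hM v
  field_simp
  ring

theorem trace_inv_add_vecMulVec {M : Matrix n n ℝ} (hM : M.PosDef) (v : n → ℝ) :
    (M + vecMulVec v v)⁻¹.trace =
      M⁻¹.trace - ((M⁻¹ *ᵥ v) ⬝ᵥ (M⁻¹ *ᵥ v)) / (1 + v ⬝ᵥ (M⁻¹ *ᵥ v)) := by
  rw [inv_add_vecMulVec hM, trace_sub, trace_smul, trace_vecMulVec, smul_eq_mul]
  ring

/-- Cauchy–Schwarz at a basis vector; it lets the trace bound below use only the diagonal of `G`. -/
theorem one_le_diag_mul_inv_diag {M : Matrix n n ℝ} (hM : M.PosDef) (j : n) :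
    1 ≤ M⁻¹ j j * M j j := by
  have h := sq_dotProduct_le_inv_quad_mul_quad hM (Pi.single j 1) (Pi.single j 1)
  simpa using h

/-- The sum of the leverages of the vectors `v i` in `∑ i, v i (v i)ᵀ + e I`. -/
theorem sum_leverage_le {ι : Type*} [Fintype ι] (v : ι → n → ℝ) {e : ℝ} (he : 0 < e)
    {G : Matrix n n ℝ} (hG : G = ∑ i, vecMulVec (v i) (v i) + e • (1 : Matrix n n ℝ))
    (hpd : G.PosDef) :
    ∑ i, v i ⬝ᵥ (G⁻¹ *ᵥ v i) ≤ ∑ j, (∑ i, v i j ^ 2) / (∑ i, v i j ^ 2 + e) := by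
  have h1 : ∑ i, v i ⬝ᵥ (G⁻¹ *ᵥ v i) = (G⁻¹ * ∑ i, vecMulVec (v i) (v i)).trace := by
    rw [Finset.mul_sum, trace_sum]
    refine Finset.sum_congr rfl fun i _ => ?_
    rw [mul_vecMulVec, trace_vecMulVec, dotProduct_comm]
  have h2 : ∑ i, vecMulVec (v i) (v i) = G - e • (1 : Matrix n n ℝ) := by rw [hG]; abel
  rw [h1, h2, mul_sub, Matrix.nonsing_inv_mul _ ((Matrix.isUnit_iff_isUnit_det _).1 hpd.isUnit),
    Matrix.mul_smul, mul_one, trace]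
  -- The leverages sum to `tr(I - e G⁻¹)`, and each diagonal entry is at most `1 - e / G j j`.
  refine Finset.sum_le_sum fun j _ => ?_
  have h3 : G j j = ∑ i, v i j ^ 2 + e := by
    rw [hG]; simp [Matrix.sum_apply, vecMulVec_apply, sq]
  have h4 := one_le_diag_mul_inv_diag hpd j
  rw [h3] at h4
  have h5 : 0 ≤ ∑ i, v i j ^ 2 := Finset.sum_nonneg fun i _ => sq_nonneg _
  simp only [diag_apply, Matrix.sub_apply, one_apply_eq, Matrix.smul_apply, smul_eq_mul]
  rw [le_div_iff₀ (by positivity)]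
  nlinarith

theorem posDef_sum_vecMulVec_add {ι : Type*} (s : Finset ι) (v : ι → n → ℝ) {e : ℝ} (he : 0 < e) :
    (∑ i ∈ s, vecMulVec (v i) (v i) + e • (1 : Matrix n n ℝ)).PosDef := by
  refine Matrix.PosDef.posSemidef_add (posSemidef_sum s fun i _ => ?_) (PosDef.one.smul he)
  simpa using posSemidef_vecMulVec_self_star (v i)

/-- A determinant-maximising selection of `m` vectors bounds the leverage of every vector. -/
theorem exists_selection_inv_quad_le {β : Type*} [Finite β] [Nonempty β] (u : β → n → ℝ) {e : ℝ}
    (he : 0 < e) {m : ℕ} (hm : 0 < m) {θ : ℝ} (hθ : 0 ≤ θ)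
    (htr : ∀ a : Fin m → β,
      ∑ j, (∑ i, u (a i) j ^ 2) / (∑ i, u (a i) j ^ 2 + e) ≤ m * (θ / (1 + θ))) :
    ∃ a : Fin m → β, ∀ b, u b ⬝ᵥ
      ((∑ i, vecMulVec (u (a i)) (u (a i)) + e • (1 : Matrix n n ℝ))⁻¹ *ᵥ u b) ≤ θ := by
  classical
  obtain ⟨a, ha⟩ := Finite.exists_max fun a : Fin m → β =>
    (∑ i, vecMulVec (u (a i)) (u (a i)) + e • (1 : Matrix n n ℝ)).det
  refine ⟨a, fun b => ?_⟩
  by_contra! hb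
  set G := ∑ i, vecMulVec (u (a i)) (u (a i)) + e • (1 : Matrix n n ℝ) with hG
  have hpd : G.PosDef := posDef_sum_vecMulVec_add _ _ he
  -- Swapping `a i` for `b` cannot raise the determinant, so over the remaining matrix `N` the value
  -- `q` of `a i` is at least that of `b`, which exceeds `θ`. The leverage of `a i` in `G` is `q /
  -- (1 + q)`.
  have hlev : ∀ i, θ / (1 + θ) < u (a i) ⬝ᵥ (G⁻¹ *ᵥ u (a i)) := by
    intro i
    set N := ∑ k ∈ Finset.univ.erase i, vecMulVec (u (a k)) (u (a k)) + e • (1 : Matrix n n ℝ)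
      with hN
    have hNpd : N.PosDef := posDef_sum_vecMulVec_add _ _ he
    have hGN : G = N + vecMulVec (u (a i)) (u (a i)) := by
      rw [hG, hN, ← Finset.add_sum_erase _ _ (Finset.mem_univ i)]; abel
    have hswap : ∑ k, vecMulVec (u (Function.update a i b k)) (u (Function.update a i b k))
        + e • (1 : Matrix n n ℝ) = N + vecMulVec (u b) (u b) := by
      rw [hN, ← Finset.add_sum_erase _ _ (Finset.mem_univ i), Function.update_self]
      have : ∑ k ∈ Finset.univ.erase i,
          vecMulVec (u (Function.update a i b k)) (u (Function.update a i b k))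
          = ∑ k ∈ Finset.univ.erase i, vecMulVec (u (a k)) (u (a k)) :=
        Finset.sum_congr rfl fun k hk => by
          rw [Function.update_of_ne (Finset.ne_of_mem_erase hk)]
      rw [this]; abel
    have hmax := ha (Function.update a i b)
    rw [hswap, hGN, det_add_vecMulVec hNpd, det_add_vecMulVec hNpd] at hmax
    have hle : u b ⬝ᵥ (N⁻¹ *ᵥ u b) ≤ u (a i) ⬝ᵥ (N⁻¹ *ᵥ u (a i)) := by
      have := le_of_mul_le_mul_left hmax hNpd.det_pos
      linarith
    have hmono := inv_quad_add_vecMulVec_le hNpd (u (a i)) (u b)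
    rw [← hGN] at hmono
    rw [hGN, inv_quad_add_vecMulVec_self hNpd, div_lt_div_iff₀ (by positivity)
      (by have := inv_quad_nonneg hNpd (u (a i)); positivity)]
    nlinarith
  have h1 := sum_leverage_le (fun i => u (a i)) he hG hpd
  have h2 : ∑ _i : Fin m, θ / (1 + θ) < ∑ i, u (a i) ⬝ᵥ (G⁻¹ *ᵥ u (a i)) :=
    Finset.sum_lt_sum_of_nonempty ⟨⟨0, hm⟩, Finset.mem_univ _⟩ fun i _ => hlev i
  simp only [Finset.sum_const, Finset.card_univ, Fintype.card_fin, nsmul_eq_mul] at h2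
  linarith [htr a]

end Matrices

end PTRBandit

end

/-! ### The one-sided barrier argument. -/

noncomputable section

namespace PTRBandit

section Barrier

open Matrix

variable {n : Type*} [Fintype n] [DecidableEq n]

theorem quad_le_trace_mul {n : Type*} [Fintype n] {P : Matrix n n ℝ} (hP : P.PosSemidef)
    (z : n → ℝ) : z ⬝ᵥ (P *ᵥ z) ≤ P.trace * (z ⬝ᵥ z) := by
  obtain ⟨m, v, rfl⟩ := Matrix.posSemidef_iff_eq_sum_vecMulVec.1 hP
  rw [sum_mulVec, dotProduct_sum, trace_sum, Finset.sum_mul]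
  refine Finset.sum_le_sum fun i _ => ?_
  rw [star_trivial, vecMulVec_mulVec, op_smul_eq_smul, dotProduct_smul, smul_eq_mul,
    dotProduct_comm z, trace_vecMulVec, ← sq]
  simpa [dotProduct, sq] using Finset.sum_mul_sq_le_sq_mul_sq Finset.univ (v i) z

theorem trace_mul_nonneg {n : Type*} [Fintype n] {P K : Matrix n n ℝ} (hP : P.PosSemidef)
    (hK : K.PosSemidef) : 0 ≤ (P * K).trace := by
  obtain ⟨m, v, rfl⟩ := Matrix.posSemidef_iff_eq_sum_vecMulVec.1 hP
  rw [trace_mul_comm, Finset.mul_sum, trace_sum]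
  refine Finset.sum_nonneg fun i _ => ?_
  rw [star_trivial, mul_vecMulVec, trace_vecMulVec, dotProduct_comm]
  simpa using hK.dotProduct_mulVec_nonneg (v i)

/-- For positive semidefinite matrices the largest eigenvalue is at most the trace; expand `P` into
rank-one terms. -/
theorem trace_mul_le {n : Type*} [Fintype n] {P K : Matrix n n ℝ} (hP : P.PosSemidef)
    (hK : K.PosSemidef) : (P * K).trace ≤ P.trace * K.trace := by
  obtain ⟨m, v, rfl⟩ := Matrix.posSemidef_iff_eq_sum_vecMulVec.1 hP
  rw [trace_mul_comm, Finset.mul_sum, trace_sum, trace_sum, Finset.sum_mul]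
  refine Finset.sum_le_sum fun i _ => ?_
  rw [star_trivial, mul_vecMulVec, trace_vecMulVec, dotProduct_comm, trace_vecMulVec, mul_comm]
  exact quad_le_trace_mul hK (v i)

/-- One step of the lower barrier argument: the barrier moves up by `3 / 4`. -/
theorem exists_barrier_step {β : Type*} [Fintype β] {w : β → ℝ} (hw : ∀ x, 0 ≤ w x)
    (hw1 : ∑ x, w x = 1) {v : β → n → ℝ}
    (hv : ∑ x, w x • vecMulVec (v x) (v x) = (1 : Matrix n n ℝ)) {M : Matrix n n ℝ}
    (hM : M.PosDef) (htr : M⁻¹.trace ≤ 1 / 4) :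
    ∃ x, w x ≠ 0 ∧ (M - (3 / 4 : ℝ) • (1 : Matrix n n ℝ) + vecMulVec (v x) (v x)).PosDef ∧
      (M - (3 / 4 : ℝ) • (1 : Matrix n n ℝ) + vecMulVec (v x) (v x))⁻¹.trace ≤ 1 / 4 := by
  set N := M - (3 / 4 : ℝ) • (1 : Matrix n n ℝ) with hN
  have hNpd : N.PosDef := by
    refine PosDef.of_dotProduct_mulVec_pos ?_ fun {z} hz => ?_
    · exact hM.isHermitian.sub (PosDef.one.smul (by norm_num : (0 : ℝ) < 3 / 4)).isHermitian
    · have h1 := sq_dotProduct_le_inv_quad_mul_quad hM z z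
      have h2 := quad_le_trace_mul hM.inv.posSemidef z
      have h3 : 0 < z ⬝ᵥ z := by
        simpa using (PosDef.one (n := n) (R := ℝ)).dotProduct_mulVec_pos hz
      have h4 : 0 ≤ z ⬝ᵥ (M *ᵥ z) := by simpa using hM.posSemidef.dotProduct_mulVec_nonneg z
      -- A trace of `M⁻¹` of at most `1/4` forces `M ≥ 4 I`, so a shift by `3/4` keeps it positive
      -- definite.
      have h5 : 4 * (z ⬝ᵥ z) ≤ z ⬝ᵥ (M *ᵥ z) := by
        have : (z ⬝ᵥ z) ^ 2 ≤ (1 / 4 * (z ⬝ᵥ z)) * (z ⬝ᵥ (M *ᵥ z)) :=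
          h1.trans (mul_le_mul_of_nonneg_right (h2.trans (by gcongr)) h4)
        nlinarith
      rw [hN, sub_mulVec, smul_mulVec, one_mulVec, dotProduct_sub, dotProduct_smul, star_trivial,
        smul_eq_mul]
      linarith
  set U := N⁻¹ with hU
  set K := M⁻¹ with hK
  have hUp := hNpd.inv.posSemidef
  have hKp := hM.inv.posSemidef
  rw [← hU] at hUp
  rw [← hK] at hKp
  have hUT : Uᵀ = U := by simpa using hUp.isHermitian.eq
  have hUK : U = K + (3 / 4 : ℝ) • (U * K) := by
    have h1 : M * K = 1 := Matrix.mul_nonsing_inv _ ((Matrix.isUnit_iff_isUnit_det _).1 hM.isUnit)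
    have h2 : U * N = 1 :=
      Matrix.nonsing_inv_mul _ ((Matrix.isUnit_iff_isUnit_det _).1 hNpd.isUnit)
    have h3 : M = N + (3 / 4 : ℝ) • (1 : Matrix n n ℝ) := by rw [hN]; abel
    calc U = U * (M * K) := by rw [h1, mul_one]
      _ = U * (N + (3 / 4 : ℝ) • (1 : Matrix n n ℝ)) * K := by rw [← h3, mul_assoc]
      _ = K + (3 / 4 : ℝ) • (U * K) := by
        rw [mul_add, h2, add_mul, one_mul, Matrix.mul_smul, mul_one, Matrix.smul_mul]
  have t1 : U.trace = K.trace + 3 / 4 * (U * K).trace := by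
    conv_lhs => rw [hUK]
    rw [trace_add, trace_smul, smul_eq_mul]
  have t2 : (U * U).trace = (U * K).trace + 3 / 4 * (U * U * K).trace := by
    calc (U * U).trace = (U * (K + (3 / 4 : ℝ) • (U * K))).trace := by rw [← hUK]
      _ = _ := by rw [mul_add, trace_add, Matrix.mul_smul, trace_smul, smul_eq_mul, mul_assoc]
  have t3 : 0 ≤ (U * U * K).trace := by
    refine trace_mul_nonneg ?_ hKp
    have := posSemidef_conjTranspose_mul_self U
    rwa [conjTranspose_eq_transpose_of_trivial, hUT] at this
  have t4 := trace_mul_le hUp hKp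
  have t5 := trace_mul_nonneg hUp hKp
  have t6 := hUp.trace_nonneg
  -- Write `U - K = (3/4) U K`. Then `tr U ≤ 1/4 + (3/16) tr U`, and the shift `3/4` is admissible
  -- because `(3/4)(1 + 4/13) = 51/52 ≤ 1`.
  have t7 : U.trace ≤ 4 / 13 := by nlinarith
  have t8 : (U.trace - K.trace) * (1 + U.trace) ≤ (U * U).trace := by nlinarith
  have s1 : ∑ x, w x * ((U *ᵥ v x) ⬝ᵥ (U *ᵥ v x)) = (U * U).trace := by
    calc _ = (U * (∑ x, w x • vecMulVec (v x) (v x)) * U).trace := by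
          rw [Finset.mul_sum, Finset.sum_mul, trace_sum]
          refine Finset.sum_congr rfl fun x _ => ?_
          rw [Matrix.mul_smul, Matrix.smul_mul, trace_smul, smul_eq_mul, mul_vecMulVec,
            vecMulVec_mul, ← mulVec_transpose, hUT, trace_vecMulVec]
      _ = _ := by rw [hv, mul_one]
  have s2 : ∑ x, w x * (1 + v x ⬝ᵥ (U *ᵥ v x)) = 1 + U.trace := by
    simp only [mul_add, mul_one, Finset.sum_add_distrib, hw1]
    congr 1
    calc _ = (U * (∑ x, w x • vecMulVec (v x) (v x))).trace := by
          rw [Finset.mul_sum, trace_sum]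
          refine Finset.sum_congr rfl fun x _ => ?_
          rw [Matrix.mul_smul, trace_smul, smul_eq_mul, mul_vecMulVec, trace_vecMulVec,
            dotProduct_comm]
      _ = _ := by rw [hv, mul_one]
  -- By isotropy, averaging over `w` turns the two sides into those of `t8`; some `x` in the support
  -- of `w` does at least as well as the average. For it the rank-one update lowers the trace by no
  -- less than the shift raised it.
  have hex : ∃ x, w x ≠ 0 ∧ (U.trace - K.trace) * (1 + v x ⬝ᵥ (U *ᵥ v x)) ≤
      (U *ᵥ v x) ⬝ᵥ (U *ᵥ v x) := by
    by_contra! hcon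
    obtain ⟨x₀, hx₀⟩ : ∃ x, w x ≠ 0 := by
      by_contra! h0
      simp [h0] at hw1
    have : ∑ x, w x * ((U *ᵥ v x) ⬝ᵥ (U *ᵥ v x)) <
        ∑ x, w x * ((U.trace - K.trace) * (1 + v x ⬝ᵥ (U *ᵥ v x))) := by
      refine Finset.sum_lt_sum (fun x _ => ?_) ⟨x₀, Finset.mem_univ _, ?_⟩
      · by_cases hx : w x = 0
        · simp [hx]
        · exact mul_le_mul_of_nonneg_left (hcon x hx).le (hw x)
      · exact mul_lt_mul_of_pos_left (hcon x₀ hx₀) (lt_of_le_of_ne (hw x₀) hx₀.symm)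
    have h2 : ∑ x, w x * ((U.trace - K.trace) * (1 + v x ⬝ᵥ (U *ᵥ v x))) =
        (U.trace - K.trace) * ∑ x, w x * (1 + v x ⬝ᵥ (U *ᵥ v x)) := by
      rw [Finset.mul_sum]
      exact Finset.sum_congr rfl fun x _ => by ring
    rw [h2, s1, s2] at this
    linarith
  obtain ⟨x, hx0, hx⟩ := hex
  refine ⟨x, hx0, posDef_add_vecMulVec hNpd _, ?_⟩
  rw [trace_inv_add_vecMulVec hNpd]
  have hq := inv_quad_nonneg hNpd (v x)
  have : U.trace - K.trace ≤ ((U *ᵥ v x) ⬝ᵥ (U *ᵥ v x)) / (1 + v x ⬝ᵥ (U *ᵥ v x)) := by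
    rw [le_div_iff₀ (by positivity)]
    exact hx
  linarith

/-- The lower barrier argument: from an isotropic distribution one selects `t` vectors `v` with
`∑ v vᵀ ≥ (3 t / 4 - 4 d) I`. -/
theorem exists_selection_lower_bound {β : Type*} [Fintype β] {w : β → ℝ} (hw : ∀ x, 0 ≤ w x)
    (hw1 : ∑ x, w x = 1) {v : β → n → ℝ}
    (hv : ∑ x, w x • vecMulVec (v x) (v x) = (1 : Matrix n n ℝ)) [Nonempty n] (t : ℕ) :
    ∃ s : ℕ → β, (∀ i < t, w (s i) ≠ 0) ∧ ∀ z : n → ℝ,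
      (3 / 4 * t - 4 * Fintype.card n) * (z ⬝ᵥ z) ≤ ∑ i ∈ Finset.range t, (v (s i) ⬝ᵥ z) ^ 2 := by
  have hd : (0 : ℝ) < Fintype.card n := by exact_mod_cast Fintype.card_pos
  -- The barrier starts at `-4d`, where the potential is exactly `d / (4d) = 1/4`.
  have main : ∃ s : ℕ → β, (∀ i < t, w (s i) ≠ 0) ∧
      ((4 * Fintype.card n - 3 / 4 * t : ℝ) • (1 : Matrix n n ℝ) +
        ∑ i ∈ Finset.range t, vecMulVec (v (s i)) (v (s i))).PosDef ∧
      ((4 * Fintype.card n - 3 / 4 * t : ℝ) • (1 : Matrix n n ℝ) +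
        ∑ i ∈ Finset.range t, vecMulVec (v (s i)) (v (s i)))⁻¹.trace ≤ 1 / 4 := by
    induction t with
    | zero =>
      obtain ⟨x₀, -⟩ : ∃ x, w x ≠ 0 := by
        by_contra! h0
        simp [h0] at hw1
      refine ⟨fun _ => x₀, by simp, ?_, ?_⟩
      · simpa using PosDef.one.smul (by positivity : (0 : ℝ) < 4 * Fintype.card n)
      · have hinv : ((4 * Fintype.card n : ℝ) • (1 : Matrix n n ℝ))⁻¹
            = (4 * Fintype.card n : ℝ)⁻¹ • (1 : Matrix n n ℝ) := by
          apply inv_eq_right_inv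
          rw [Matrix.smul_mul, one_mul, smul_smul, mul_inv_cancel₀ (by positivity), one_smul]
        simp only [Nat.cast_zero, mul_zero, sub_zero, Finset.range_zero, Finset.sum_empty,
          add_zero, hinv, trace_smul, trace_one, smul_eq_mul]
        field_simp
        norm_num
    | succ t ih =>
      obtain ⟨s, hs, hpd, htr⟩ := ih
      obtain ⟨x, hx, hpd', htr'⟩ := exists_barrier_step hw hw1 hv hpd htr
      have heq : (4 * Fintype.card n - 3 / 4 * (t + 1 : ℕ) : ℝ) • (1 : Matrix n n ℝ) +
          ∑ i ∈ Finset.range (t + 1), vecMulVec (v (Function.update s t x i))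
            (v (Function.update s t x i)) =
          (4 * Fintype.card n - 3 / 4 * t : ℝ) • (1 : Matrix n n ℝ) +
            ∑ i ∈ Finset.range t, vecMulVec (v (s i)) (v (s i)) -
            (3 / 4 : ℝ) • (1 : Matrix n n ℝ) + vecMulVec (v x) (v x) := by
        rw [Finset.sum_range_succ, Function.update_self]
        have : ∑ i ∈ Finset.range t, vecMulVec (v (Function.update s t x i))
            (v (Function.update s t x i)) = ∑ i ∈ Finset.range t, vecMulVec (v (s i)) (v (s i)) :=
          Finset.sum_congr rfl fun i hi => by
            rw [Function.update_of_ne (Finset.mem_range.1 hi).ne]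
        rw [this]
        push_cast
        module
      refine ⟨Function.update s t x, fun i hi => ?_, ?_, ?_⟩
      · rcases Nat.lt_succ_iff_lt_or_eq.1 hi with h | rfl
        · rw [Function.update_of_ne h.ne]; exact hs i h
        · rwa [Function.update_self]
      · rw [heq]; exact hpd'
      · rw [heq]; exact htr'
  obtain ⟨s, hs, hpd, -⟩ := main
  refine ⟨s, hs, fun z => ?_⟩
  have h := hpd.posSemidef.dotProduct_mulVec_nonneg z
  rw [star_trivial, add_mulVec, smul_mulVec, one_mulVec, dotProduct_add, dotProduct_smul,
    sum_mulVec, dotProduct_sum, smul_eq_mul] at h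
  have h2 : ∑ i ∈ Finset.range t, z ⬝ᵥ (vecMulVec (v (s i)) (v (s i)) *ᵥ z) =
      ∑ i ∈ Finset.range t, (v (s i) ⬝ᵥ z) ^ 2 := by
    refine Finset.sum_congr rfl fun i _ => ?_
    rw [vecMulVec_mulVec, op_smul_eq_smul, dotProduct_smul, smul_eq_mul, dotProduct_comm z, sq]
  rw [h2] at h
  linarith

end Barrier

end PTRBandit

end

/-! ### Rounding a design in eigencoordinates. -/

noncomputable section

namespace PTRBandit

section Selection

open Matrix

variable {α n : Type*} [Fintype n]

/-- Rounding for the worst-case variance: `u x` are coordinates in which the design operator is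
diagonal with eigenvalues `d j`. -/
theorem exists_selection_worst_case (V : Finset α) (hV : V.Nonempty) (u : α → n → ℝ) {d : n → ℝ}
    (hd : ∀ j, 0 ≤ d j) {γ : ℝ} (hγ : 0 < γ) {τ m : ℕ} (hm : 0 < m) (hτm : τ ≤ 2 * m)
    (hmτ : m ≤ τ) (hJ : 64 * (Finset.univ.filter fun j => γ ≤ d j).card ≤ τ) {r : ℝ}
    (hr : ∀ v ∈ V, ∑ j, u v j ^ 2 / (τ * (d j + γ)) ≤ r)
    (htr : ∑ j, d j / (d j + γ) ≤ τ * r) :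
    ∃ s : Fin m → α, (∀ i, s i ∈ V) ∧ ∀ v ∈ V, ∀ z : n → ℝ,
      (u v ⬝ᵥ z) ^ 2 ≤ 4 * r * (∑ i, (u (s i) ⬝ᵥ z) ^ 2 + τ * γ * (z ⬝ᵥ z)) := by
  classical
  have hτ : (0 : ℝ) < τ := by exact_mod_cast hm.trans_le hmτ
  have hm0 : (0 : ℝ) < m := by exact_mod_cast hm
  have hτm' : (τ : ℝ) ≤ 2 * m := by exact_mod_cast hτm
  have hmτ' : (m : ℝ) ≤ τ := by exact_mod_cast hmτ
  have hpos : ∀ j, 0 < d j + γ := fun j => by have := hd j; positivity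
  have hr0 : 0 ≤ r := by
    obtain ⟨v, hv⟩ := hV
    exact le_trans (Finset.sum_nonneg fun j _ => div_nonneg (sq_nonneg _)
      (mul_nonneg hτ.le (hpos j).le)) (hr v hv)
  have : Nonempty V := hV.to_subtype
  -- reduction to the choice of a regularisation factor
  have key : ∀ η : ℝ, 1 ≤ η → (∀ a : Fin m → V,
      ∑ j, (∑ i, u (a i) j ^ 2) / (∑ i, u (a i) j ^ 2 + η * (τ * γ)) ≤
        m * ((4 * r / η) / (1 + 4 * r / η))) →
      ∃ s : Fin m → α, (∀ i, s i ∈ V) ∧ ∀ v ∈ V, ∀ z : n → ℝ,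
        (u v ⬝ᵥ z) ^ 2 ≤ 4 * r * (∑ i, (u (s i) ⬝ᵥ z) ^ 2 + τ * γ * (z ⬝ᵥ z)) := by
    intro η hη h
    have hη0 : 0 < η := by linarith
    have he : 0 < η * (τ * γ) := by positivity
    obtain ⟨a, ha⟩ := exists_selection_inv_quad_le (fun v : V => u v) he hm
      (by positivity : 0 ≤ 4 * r / η) h
    refine ⟨fun i => a i, fun i => (a i).2, fun v hv z => ?_⟩
    have hpd := posDef_sum_vecMulVec_add Finset.univ (fun i => u (a i)) he
    have h1 := sq_dotProduct_le_inv_quad_mul_quad hpd (u v) z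
    have h2 : z ⬝ᵥ ((∑ i, vecMulVec (u (a i)) (u (a i)) + (η * (τ * γ)) • (1 : Matrix n n ℝ)) *ᵥ z)
        = ∑ i, (u (a i) ⬝ᵥ z) ^ 2 + η * (τ * γ) * (z ⬝ᵥ z) := by
      rw [add_mulVec, smul_mulVec, one_mulVec, dotProduct_add, dotProduct_smul, sum_mulVec,
        dotProduct_sum, smul_eq_mul]
      congr 1
      refine Finset.sum_congr rfl fun i _ => ?_
      rw [vecMulVec_mulVec, op_smul_eq_smul, dotProduct_smul, smul_eq_mul, dotProduct_comm z, sq]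
    rw [h2] at h1
    have h0 : 0 ≤ ∑ i, (u (a i) ⬝ᵥ z) ^ 2 := Finset.sum_nonneg fun i _ => sq_nonneg _
    have h0' : 0 ≤ z ⬝ᵥ z := Finset.sum_nonneg fun i _ => mul_self_nonneg _
    calc (u v ⬝ᵥ z) ^ 2 ≤ _ := h1
      _ ≤ 4 * r / η * (∑ i, (u (a i) ⬝ᵥ z) ^ 2 + η * (τ * γ) * (z ⬝ᵥ z)) :=
        mul_le_mul_of_nonneg_right (ha ⟨v, hv⟩) (by positivity)
      _ = 4 * r * ((∑ i, (u (a i) ⬝ᵥ z) ^ 2) / η + τ * γ * (z ⬝ᵥ z)) := by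
        field_simp
      _ ≤ _ := by
        gcongr
        exact div_le_self h0 hη
  have hsum : ∀ a : Fin m → V,
      ∑ j, (∑ i, u (a i) j ^ 2) / (τ * (d j + γ)) ≤ m * r := by
    intro a
    simp only [Finset.sum_div]
    rw [Finset.sum_comm]
    calc _ ≤ ∑ _i : Fin m, r := Finset.sum_le_sum fun i _ => hr _ (a i).2
      _ = m * r := by simp
  have hS : ∀ (a : Fin m → V) (j : n), 0 ≤ ∑ i, u (a i) j ^ 2 := fun a j =>
    Finset.sum_nonneg fun i _ => sq_nonneg _
  rcases le_or_gt r (1 / 12) with hsmall | hbig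
  -- Small variance: the trace is at most `τ r + m r ≤ 3 m r`, and `3r ≤ 4r / (1 + 4r)` exactly when
  -- `r ≤ 1/12`. No dimension is needed here.
  · refine key 1 le_rfl fun a => ?_
    have h1 : ∀ j, (∑ i, u (a i) j ^ 2) / (∑ i, u (a i) j ^ 2 + 1 * (τ * γ)) ≤
        d j / (d j + γ) + (∑ i, u (a i) j ^ 2) / (τ * (d j + γ)) := by
      intro j
      have hs := hS a j
      generalize ∑ i, u (a i) j ^ 2 = s at hs ⊢
      have hj := hd j
      have hp := hpos j
      have : d j / (d j + γ) + s / (τ * (d j + γ)) = (τ * d j + s) / (τ * (d j + γ)) := by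
        field_simp
      rw [this, div_le_div_iff₀ (by positivity) (by positivity)]
      nlinarith [mul_nonneg hs hs, mul_nonneg (mul_nonneg hτ.le hj) hτ.le,
        mul_nonneg (mul_nonneg (mul_nonneg hτ.le hj) hτ.le) hγ.le]
    calc _ ≤ ∑ j, (d j / (d j + γ) + (∑ i, u (a i) j ^ 2) / (τ * (d j + γ))) :=
          Finset.sum_le_sum fun j _ => h1 j
      _ ≤ τ * r + m * r := by
          rw [Finset.sum_add_distrib]; exact add_le_add htr (hsum a)
      _ ≤ m * (3 * r) := by nlinarith
      _ ≤ _ := by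
          gcongr
          rw [div_one, le_div_iff₀ (by positivity)]
          nlinarith
  -- Otherwise `η = 12r` makes the target leverage `1/3`, so the trace may be as large as `m / 4`.
  -- Top coordinates cost at most one each, in total `m / 32`, and the others `m / 6`.
  · refine key (12 * r) (by linarith) fun a => ?_
    have h1 : ∀ j, (∑ i, u (a i) j ^ 2) / (∑ i, u (a i) j ^ 2 + 12 * r * (τ * γ)) ≤
        (if γ ≤ d j then 1 else 0) +
          1 / (6 * r) * ((∑ i, u (a i) j ^ 2) / (τ * (d j + γ))) := by
      intro j
      have hs := hS a j
      generalize ∑ i, u (a i) j ^ 2 = s at hs ⊢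
      have hj := hd j
      have hp := hpos j
      have hr1 : 0 < r := by linarith
      split_ifs with hcase
      · have : s / (s + 12 * r * (τ * γ)) ≤ 1 := by
          rw [div_le_one (by positivity)]
          have : 0 ≤ 12 * r * (τ * γ) := by positivity
          linarith
        have : 0 ≤ 1 / (6 * r) * (s / (τ * (d j + γ))) := by positivity
        linarith
      · rw [zero_add, div_mul_div_comm, one_mul]
        push Not at hcase
        apply div_le_div_of_nonneg_left hs (by positivity)
        have : 6 * r * (τ * (d j + γ)) ≤ 6 * r * (τ * (γ + γ)) := by gcongr
        linarith
    have hcard : ((Finset.univ.filter fun j => γ ≤ d j).card : ℝ) ≤ m / 32 := by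
      have : (64 * (Finset.univ.filter fun j => γ ≤ d j).card : ℝ) ≤ τ := by exact_mod_cast hJ
      linarith
    have hr1 : 0 < r := by linarith
    calc _ ≤ ∑ j, ((if γ ≤ d j then (1 : ℝ) else 0) +
          1 / (6 * r) * ((∑ i, u (a i) j ^ 2) / (τ * (d j + γ)))) :=
          Finset.sum_le_sum fun j _ => h1 j
      _ ≤ m / 32 + 1 / (6 * r) * (m * r) := by
          rw [Finset.sum_add_distrib, ← Finset.mul_sum, Finset.sum_boole]
          gcongr
          exact hsum a
      _ = m * (1 / 32 + 1 / 6) := by field_simp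
      _ ≤ _ := by
          gcongr
          have : 4 * r / (12 * r) = 1 / 3 := by field_simp; norm_num
          rw [this]; norm_num

/-- Rounding after projection: if `u x` are coordinates in which the design operator is diagonal
with eigenvalues `d j`, then `t` measurements reproduce it on the coordinates in `J`. -/
theorem exists_selection_projected [Fintype α] [DecidableEq n] {w : α → ℝ} (hw : ∀ x, 0 ≤ w x)
    (hw1 : ∑ x, w x = 1)
    {u : α → n → ℝ} {d : n → ℝ} (hu : ∀ j k, ∑ x, w x * (u x j * u x k) = if j = k then d j else 0)
    (J : Finset n) (hJ : ∀ j ∈ J, 0 < d j) (hJ0 : J.Nonempty) (t : ℕ) :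
    ∃ s : ℕ → α, (∀ i < t, w (s i) ≠ 0) ∧ ∀ z : n → ℝ, (∀ j ∉ J, z j = 0) →
      (3 / 4 * t - 4 * J.card) * ∑ j, d j * z j ^ 2 ≤
        ∑ i ∈ Finset.range t, (u (s i) ⬝ᵥ z) ^ 2 := by
  have hsq : ∀ j : J, 0 < √(d j) := fun j => Real.sqrt_pos.2 (hJ _ j.2)
  have : Nonempty J := hJ0.to_subtype
  -- Dividing coordinate `j` by `√(d j)` makes the design isotropic on `J`.
  obtain ⟨s, hs, h⟩ := exists_selection_lower_bound (n := J) hw hw1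
    (v := fun x j => u x j / √(d j)) (by
      refine Matrix.ext fun j k => ?_
      rw [Matrix.sum_apply, Matrix.one_apply]
      simp only [Matrix.smul_apply, vecMulVec_apply, smul_eq_mul]
      have h1 : ∀ x, w x * (u x j / √(d j) * (u x k / √(d k))) =
          w x * (u x j * u x k) / (√(d j) * √(d k)) := fun x => by
        rw [div_mul_div_comm]; exact (mul_div_assoc _ _ _).symm
      simp only [h1]
      rw [← Finset.sum_div, hu]
      by_cases hjk : j = k
      · subst hjk
        rw [if_pos rfl, if_pos rfl, Real.mul_self_sqrt (hJ _ j.2).le, div_self (hJ _ j.2).ne']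
      · rw [if_neg (fun h => hjk (Subtype.ext h)), if_neg hjk, zero_div]) t
  refine ⟨s, hs, fun z hz => ?_⟩
  have h2 := h fun j => √(d j) * z j
  have e0 : ∀ g : n → ℝ, (∀ j ∉ J, g j = 0) → ∑ j : J, g j = ∑ j, g j := by
    intro g hg
    rw [Finset.sum_coe_sort J g]
    exact Finset.sum_subset (Finset.subset_univ J) fun j _ hj => hg j hj
  have e1 : (fun j : J => √(d j) * z j) ⬝ᵥ (fun j : J => √(d j) * z j) = ∑ j, d j * z j ^ 2 := by
    rw [← e0 _ fun j hj => by simp [hz j hj]]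
    refine Finset.sum_congr rfl fun j _ => ?_
    rw [mul_mul_mul_comm, Real.mul_self_sqrt (hJ _ j.2).le, sq]
  have e2 : ∀ x, (fun j : J => u x j / √(d j)) ⬝ᵥ (fun j : J => √(d j) * z j) = u x ⬝ᵥ z := by
    intro x
    rw [dotProduct, dotProduct, ← e0 _ fun j hj => by simp [hz j hj]]
    refine Finset.sum_congr rfl fun j _ => ?_
    have := (hsq j).ne'
    field_simp
  rw [e1, Fintype.card_coe] at h2
  simpa only [e2] using h2

end Selection

end PTRBandit

end

/-! ### Regularised inverses of positive operators. -/

noncomputable section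

namespace PTRBandit

section Operators

variable {α : Type*} [Fintype α] {H : Type*} [NormedAddCommGroup H] [InnerProductSpace ℝ H]

theorem isPositive_designOp (φ : α → H) {lam : α → ℝ} (h : ∀ x, 0 ≤ lam x) :
    (designOp φ lam).IsPositive :=
  ContinuousLinearMap.isPositive_sum _ fun x _ =>
    (InnerProductSpace.isPositive_rankOne_self (φ x)).smul_of_nonneg (h x)

theorem isPositive_sampleOp {α : Type*} (φ : α → H) (a : ℕ → α) (τ : ℕ) :
    (sampleOp φ a τ).IsPositive :=
  ContinuousLinearMap.isPositive_sum _ fun i _ =>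
    InnerProductSpace.isPositive_rankOne_self (φ (a i))

theorem designOp_apply (φ : α → H) (lam : α → ℝ) (z : H) :
    designOp φ lam z = ∑ x, (lam x * ⟪φ x, z⟫_ℝ) • φ x := by
  simp [designOp, smul_smul]

theorem sampleOp_apply {α : Type*} (φ : α → H) (a : ℕ → α) (τ : ℕ) (z : H) :
    sampleOp φ a τ z = ∑ i ∈ Finset.range τ, ⟪φ (a i), z⟫_ℝ • φ (a i) := by
  simp [sampleOp]

theorem inner_designOp_self (φ : α → H) (lam : α → ℝ) (z : H) :
    ⟪designOp φ lam z, z⟫_ℝ = ∑ x, lam x * ⟪φ x, z⟫_ℝ ^ 2 := by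
  rw [designOp_apply, sum_inner]
  exact Finset.sum_congr rfl fun x _ => by rw [real_inner_smul_left]; ring

theorem inner_sampleOp_self {α : Type*} (φ : α → H) (a : ℕ → α) (τ : ℕ) (z : H) :
    ⟪sampleOp φ a τ z, z⟫_ℝ = ∑ i ∈ Finset.range τ, ⟪φ (a i), z⟫_ℝ ^ 2 := by
  rw [sampleOp_apply, sum_inner]
  exact Finset.sum_congr rfl fun x _ => by rw [real_inner_smul_left]; ring

variable [CompleteSpace H]

/-- Coercivity with constant `r` gives invertibility in any Hilbert space, without compactness. -/
theorem isUnit_add_smul_one {S : H →L[ℝ] H} (hS : S.IsPositive) {r : ℝ} (hr : 0 < r) :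
    IsUnit (S + r • (1 : H →L[ℝ] H)) := by
  refine ContinuousLinearMap.isUnit_of_forall_le_norm_inner_map _ (c := r.toNNReal)
    (by simpa using hr) fun z => ?_
  have h : ⟪(S + r • (1 : H →L[ℝ] H)) z, z⟫_ℝ = ⟪S z, z⟫_ℝ + r * ‖z‖ ^ 2 := by
    simp [inner_add_left, real_inner_smul_left]
  have h0 := hS.inner_nonneg_left z
  rw [h, Real.coe_toNNReal _ hr.le, Real.norm_of_nonneg (by positivity)]
  linarith

theorem add_smul_one_apply_inverse {S : H →L[ℝ] H} (hS : S.IsPositive) {r : ℝ} (hr : 0 < r)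
    (v : H) : S (Ring.inverse (S + r • (1 : H →L[ℝ] H)) v) +
      r • Ring.inverse (S + r • (1 : H →L[ℝ] H)) v = v := by
  have h := Ring.mul_inverse_cancel _ (isUnit_add_smul_one hS hr)
  have := congrArg (fun L : H →L[ℝ] H => L v) h
  simpa using this

theorem inverse_apply_eq {S : H →L[ℝ] H} (hS : S.IsPositive) {r : ℝ} (hr : 0 < r) {v y : H}
    (h : S y + r • y = v) : Ring.inverse (S + r • (1 : H →L[ℝ] H)) v = y := by
  have h1 := Ring.inverse_mul_cancel _ (isUnit_add_smul_one hS hr)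
  have := congrArg (fun L : H →L[ℝ] H => L y) h1
  simpa [h] using this

theorem inner_inverse_comm {S : H →L[ℝ] H} (hS : S.IsPositive) {r : ℝ} (hr : 0 < r) (v w : H) :
    ⟪Ring.inverse (S + r • (1 : H →L[ℝ] H)) v, w⟫_ℝ =
      ⟪v, Ring.inverse (S + r • (1 : H →L[ℝ] H)) w⟫_ℝ := by
  set R := Ring.inverse (S + r • (1 : H →L[ℝ] H)) with hR
  have h1 := add_smul_one_apply_inverse hS hr v
  have h2 := add_smul_one_apply_inverse hS hr w
  rw [← hR] at h1 h2
  calc ⟪R v, w⟫_ℝ = ⟪R v, S (R w) + r • R w⟫_ℝ := by rw [h2]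
    _ = ⟪S (R v) + r • R v, R w⟫_ℝ := by
      rw [inner_add_right, inner_add_left, real_inner_smul_left, real_inner_smul_right,
        hS.inner_left_eq_inner_right]
    _ = ⟪v, R w⟫_ℝ := by rw [h1]

theorem invNormSq_eq {S : H →L[ℝ] H} (hS : S.IsPositive) {r : ℝ} (hr : 0 < r) (v : H) :
    invNormSq S r v = ⟪S (Ring.inverse (S + r • (1 : H →L[ℝ] H)) v),
      Ring.inverse (S + r • (1 : H →L[ℝ] H)) v⟫_ℝ +
      r * ‖Ring.inverse (S + r • (1 : H →L[ℝ] H)) v‖ ^ 2 := by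
  have h1 := add_smul_one_apply_inverse hS hr v
  rw [invNormSq]
  set y := Ring.inverse (S + r • (1 : H →L[ℝ] H)) v
  conv_lhs => rw [← h1]
  rw [inner_add_left, real_inner_smul_left, real_inner_self_eq_norm_sq]

theorem invNormSq_nonneg {S : H →L[ℝ] H} (hS : S.IsPositive) {r : ℝ} (hr : 0 < r) (v : H) :
    0 ≤ invNormSq S r v := by
  rw [invNormSq_eq hS hr]
  have := hS.inner_nonneg_left (Ring.inverse (S + r • (1 : H →L[ℝ] H)) v)
  positivity

/-- Testing with `z = (S + rI)⁻¹ v` gives `q² ≤ m q` for `q = invNormSq S r v`. With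
`sq_inner_le_invNormSq_mul` this describes `q` as the best constant in an inequality of quadratic
forms, so inverses need not be compared directly. -/
theorem invNormSq_le {S : H →L[ℝ] H} (hS : S.IsPositive) {r : ℝ} (hr : 0 < r) {v : H} {m : ℝ}
    (hm : 0 ≤ m) (h : ∀ z, ⟪v, z⟫_ℝ ^ 2 ≤ m * (⟪S z, z⟫_ℝ + r * ‖z‖ ^ 2)) :
    invNormSq S r v ≤ m := by
  have h1 := h (Ring.inverse (S + r • (1 : H →L[ℝ] H)) v)
  rw [← invNormSq_eq hS hr] at h1
  change invNormSq S r v ^ 2 ≤ _ at h1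
  by_contra! hlt
  nlinarith

theorem sq_inner_le_invNormSq_mul {S : H →L[ℝ] H} (hS : S.IsPositive) {r : ℝ} (hr : 0 < r)
    (v z : H) : ⟪v, z⟫_ℝ ^ 2 ≤ invNormSq S r v * (⟪S z, z⟫_ℝ + r * ‖z‖ ^ 2) := by
  set y := Ring.inverse (S + r • (1 : H →L[ℝ] H)) v with hy
  have hv : S y + r • y = v := add_smul_one_apply_inverse hS hr v
  have hq := invNormSq_eq hS hr v
  rw [← hy] at hq
  have hvz : ⟪v, z⟫_ℝ = ⟪S y, z⟫_ℝ + r * ⟪y, z⟫_ℝ := by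
    rw [← hv, inner_add_left, real_inner_smul_left]
  have key : ∀ t : ℝ, 0 ≤ invNormSq S r v * (t * t) + (-2 * ⟪v, z⟫_ℝ) * t +
      (⟪S z, z⟫_ℝ + r * ‖z‖ ^ 2) := by
    intro t
    have h1 := hS.inner_nonneg_left (z - t • y)
    have h2 : 0 ≤ r * ⟪z - t • y, z - t • y⟫_ℝ := mul_nonneg hr.le real_inner_self_nonneg
    have h3 : ⟪S z, y⟫_ℝ = ⟪S y, z⟫_ℝ := by
      rw [hS.inner_left_eq_inner_right, real_inner_comm]
    simp only [map_sub, map_smul, inner_sub_left, inner_sub_right, real_inner_smul_left,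
      real_inner_smul_right, h3] at h1 h2
    rw [real_inner_comm y z, real_inner_self_eq_norm_sq, real_inner_self_eq_norm_sq] at h2
    rw [hq, hvz]
    nlinarith
  have := discrim_le_zero key
  unfold discrim at this
  nlinarith

end Operators

end PTRBandit

end

/-! ### Eigencoordinates of the design operator. -/

noncomputable section

namespace PTRBandit

section Coordinates

variable {α : Type*} [Fintype α] {H : Type*} [NormedAddCommGroup H] [InnerProductSpace ℝ H]

theorem finiteDimensional_span_range (φ : α → H) :
    FiniteDimensional ℝ (Submodule.span ℝ (Set.range φ)) :=
  FiniteDimensional.span_of_finite ℝ (Set.finite_range φ)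

theorem inner_designOp_comm (φ : α → H) (lam : α → ℝ) (y z : H) :
    ⟪designOp φ lam y, z⟫_ℝ = ⟪y, designOp φ lam z⟫_ℝ := by
  rw [designOp_apply, designOp_apply, sum_inner, inner_sum]
  refine Finset.sum_congr rfl fun x _ => ?_
  rw [real_inner_smul_left, real_inner_smul_right, real_inner_comm y (φ x)]
  ring

theorem mem_span_range_of_eigen {φ : α → H} {lam : α → ℝ} {s : ℝ} (hs : 0 < s) {z : H}
    (hz : designOp φ lam z = s • z) : z ∈ Submodule.span ℝ (Set.range φ) := by
  have : z = s⁻¹ • designOp φ lam z := by rw [hz, smul_smul, inv_mul_cancel₀ hs.ne', one_smul]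
  rw [this, designOp_apply]
  exact Submodule.smul_mem _ _ (Submodule.sum_mem _ fun x _ =>
    Submodule.smul_mem _ _ (Submodule.subset_span ⟨x, rfl⟩))

/-- Orthonormal coordinates on the span of the features, in which the design operator is
diagonal. -/
structure EigenCoords (φ : α → H) (lam : α → ℝ) where
  n : ℕ
  b : Fin n → H
  d : Fin n → ℝ
  orthonormal : Orthonormal ℝ b
  eigen : ∀ j, designOp φ lam (b j) = d j • b j
  expand : ∀ x, ∑ j, ⟪b j, φ x⟫_ℝ • b j = φ x

/-- `A(λ)` maps everything into the span of the features, so the finite-dimensional spectral theorem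
applies to its restriction there, whatever the dimension of `H`. -/
theorem nonempty_eigenCoords (φ : α → H) {lam : α → ℝ} (h : ∀ x, 0 ≤ lam x) :
    Nonempty (EigenCoords φ lam) := by
  let F := Submodule.span ℝ (Set.range φ)
  have : FiniteDimensional ℝ F := finiteDimensional_span_range φ
  have hmem : ∀ x, φ x ∈ F := fun x => Submodule.subset_span ⟨x, rfl⟩
  have hinv : ∀ z ∈ F, (designOp φ lam : H →ₗ[ℝ] H) z ∈ F := by
    intro z _
    rw [ContinuousLinearMap.coe_coe, designOp_apply]
    exact Submodule.sum_mem _ fun x _ => F.smul_mem _ (hmem x)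
  have hsym : ((designOp φ lam : H →ₗ[ℝ] H).restrict hinv).IsSymmetric :=
    LinearMap.IsSymmetric.restrict_invariant (isPositive_designOp φ h).isSymmetric hinv
  let B := hsym.eigenvectorBasis rfl
  refine ⟨⟨_, fun j => (B j : H), hsym.eigenvalues rfl, ?_, fun j => ?_, fun x => ?_⟩⟩
  · exact B.orthonormal.comp_linearIsometry F.subtypeₗᵢ
  · have := congrArg (Subtype.val : F → H) (hsym.apply_eigenvectorBasis rfl j)
    exact this
  · have := congrArg (Subtype.val : F → H) (B.sum_repr' ⟨φ x, hmem x⟩)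
    simpa using this

namespace EigenCoords

variable {φ : α → H} {lam : α → ℝ} (E : EigenCoords φ lam)

/-- The coordinates of the feature vector of `x`. -/
def coord (x : α) (j : Fin E.n) : ℝ := ⟪E.b j, φ x⟫_ℝ

/-- The coordinates whose eigenvalue is at least `γ`. -/
def top (γ : ℝ) : Finset (Fin E.n) := Finset.univ.filter fun j => γ ≤ E.d j

theorem inner_eq (x : α) (z : H) : ⟪φ x, z⟫_ℝ = E.coord x ⬝ᵥ fun j => ⟪E.b j, z⟫_ℝ := by
  conv_lhs => rw [← E.expand x]
  rw [sum_inner]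
  exact Finset.sum_congr rfl fun j _ => by rw [real_inner_smul_left]; rfl

theorem expand_of_mem_span {z : H} (hz : z ∈ Submodule.span ℝ (Set.range φ)) :
    ∑ j, ⟪E.b j, z⟫_ℝ • E.b j = z := by
  induction hz using Submodule.span_induction with
  | mem z hz =>
    obtain ⟨x, rfl⟩ := hz
    exact E.expand x
  | zero => simp
  | add y z _ _ hy hz =>
    conv_rhs => rw [← hy, ← hz]
    simp only [inner_add_right, add_smul, Finset.sum_add_distrib]
  | smul c z _ hz =>
    conv_rhs => rw [← hz]
    simp only [real_inner_smul_right, mul_smul, Finset.smul_sum]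

theorem inner_eq_ite (j k : Fin E.n) : ⟪E.b j, E.b k⟫_ℝ = if j = k then 1 else 0 :=
  orthonormal_iff_ite.1 E.orthonormal j k

theorem sum_coord_mul (j k : Fin E.n) :
    ∑ x, lam x * (E.coord x j * E.coord x k) = if j = k then E.d j else 0 := by
  have h1 : ⟪designOp φ lam (E.b j), E.b k⟫_ℝ = if j = k then E.d j else 0 := by
    rw [E.eigen, real_inner_smul_left, inner_eq_ite]
    simp
  rw [← h1, designOp_apply, sum_inner]
  refine Finset.sum_congr rfl fun x _ => ?_
  rw [real_inner_smul_left, coord, coord, real_inner_comm (φ x) (E.b j),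
    real_inner_comm (φ x) (E.b k)]
  ring

theorem d_eq (j : Fin E.n) : E.d j = ∑ x, lam x * E.coord x j ^ 2 := by
  have := E.sum_coord_mul j j
  rw [if_pos rfl] at this
  rw [← this]
  exact Finset.sum_congr rfl fun x _ => by rw [sq]

theorem d_nonneg (h : ∀ x, 0 ≤ lam x) (j : Fin E.n) : 0 ≤ E.d j := by
  rw [E.d_eq]
  exact Finset.sum_nonneg fun x _ => mul_nonneg (h x) (sq_nonneg _)

theorem inner_designOp_self (z : H) :
    ⟪designOp φ lam z, z⟫_ℝ = ∑ j, E.d j * ⟪E.b j, z⟫_ℝ ^ 2 := by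
  have h1 : ∀ x, ⟪φ x, z⟫_ℝ ^ 2 =
      ∑ j, ∑ k, ⟪E.b j, z⟫_ℝ * ⟪E.b k, z⟫_ℝ * (E.coord x j * E.coord x k) := by
    intro x
    rw [E.inner_eq, sq, dotProduct, Finset.sum_mul_sum]
    exact Finset.sum_congr rfl fun j _ => Finset.sum_congr rfl fun k _ => by ring
  rw [PTRBandit.inner_designOp_self]
  simp only [h1, Finset.mul_sum]
  rw [Finset.sum_comm]
  refine Finset.sum_congr rfl fun j _ => ?_
  rw [Finset.sum_comm]
  have h2 : ∀ k, ∑ x, lam x * (⟪E.b j, z⟫_ℝ * ⟪E.b k, z⟫_ℝ * (E.coord x j * E.coord x k)) =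
      ⟪E.b j, z⟫_ℝ * ⟪E.b k, z⟫_ℝ * if j = k then E.d j else 0 := by
    intro k
    rw [← E.sum_coord_mul j k, Finset.mul_sum]
    exact Finset.sum_congr rfl fun x _ => by ring
  simp only [h2, mul_ite, mul_zero, Finset.sum_ite_eq, Finset.mem_univ, if_true]
  ring

theorem sum_sq_le (z : H) : ∑ j, ⟪E.b j, z⟫_ℝ ^ 2 ≤ ‖z‖ ^ 2 := by
  simpa using E.orthonormal.sum_inner_products_le z (s := Finset.univ)

theorem norm_sq_eq (x : α) : ‖φ x‖ ^ 2 = ∑ j, E.coord x j ^ 2 := by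
  rw [← real_inner_self_eq_norm_sq, E.inner_eq]
  exact Finset.sum_congr rfl fun j _ => by rw [sq]; rfl

theorem invNormSq_eq [CompleteSpace H] (h : ∀ x, 0 ≤ lam x) {γ τ : ℝ} (hγ : 0 < γ) (hτ : 0 < τ)
    (x : α) : invNormSq (τ • designOp φ lam) (τ * γ) (φ x) =
      ∑ j, E.coord x j ^ 2 / (τ * (E.d j + γ)) := by
  have hpos : ∀ j, 0 < E.d j + γ := fun j => by have := E.d_nonneg h j; positivity
  have hinv : Ring.inverse (τ • designOp φ lam + (τ * γ) • (1 : H →L[ℝ] H)) (φ x) =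
      ∑ j, (E.coord x j / (τ * (E.d j + γ))) • E.b j := by
    refine inverse_apply_eq ((isPositive_designOp φ h).smul_of_nonneg hτ.le) (by positivity) ?_
    rw [smul_apply, map_sum, Finset.smul_sum, Finset.smul_sum,
      ← Finset.sum_add_distrib]
    conv_rhs => rw [← E.expand x]
    refine Finset.sum_congr rfl fun j _ => ?_
    rw [map_smul, E.eigen, smul_smul, smul_smul, smul_smul, ← add_smul]
    congr 1
    have := (hpos j).ne'
    change _ = E.coord x j
    field_simp
  rw [invNormSq, hinv, inner_sum]
  refine Finset.sum_congr rfl fun j _ => ?_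
  rw [real_inner_smul_right, real_inner_comm]
  change _ * E.coord x j = _
  ring

/-- Since `γ > 0`, a top eigenvector lies in the span of the features; by symmetry it has no
component along basis vectors of smaller eigenvalue. -/
theorem topSpace_eq {γ : ℝ} (hγ : 0 < γ) :
    topSpace φ γ lam = Submodule.span ℝ (Set.range fun j : E.top γ => E.b j) := by
  apply le_antisymm
  · refine iSup_le fun s z hz => ?_
    rw [Module.End.mem_eigenspace_iff, ContinuousLinearMap.coe_coe] at hz
    have hs : (0 : ℝ) < s := hγ.trans_le s.2
    have hexp := E.expand_of_mem_span (mem_span_range_of_eigen hs hz)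
    rw [← hexp]
    refine Submodule.sum_mem _ fun j _ => ?_
    by_cases hj : γ ≤ E.d j
    · exact Submodule.smul_mem _ _ (Submodule.subset_span
        ⟨⟨j, Finset.mem_filter.2 ⟨Finset.mem_univ _, hj⟩⟩, rfl⟩)
    · have : ⟪E.b j, z⟫_ℝ = 0 := by
        have h1 := inner_designOp_comm φ lam (E.b j) z
        rw [E.eigen, hz, real_inner_smul_left, real_inner_smul_right] at h1
        have h2 : E.d j < s := (not_le.1 hj).trans_le s.2
        by_contra h3
        exact h2.ne (mul_right_cancel₀ h3 h1)
      rw [this, zero_smul]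
      exact Submodule.zero_mem _
  · rw [Submodule.span_le]
    rintro _ ⟨j, rfl⟩
    refine Submodule.mem_iSup_of_mem (⟨E.d j, (Finset.mem_filter.1 j.2).2⟩ : {s : ℝ // γ ≤ s}) ?_
    rw [Module.End.mem_eigenspace_iff, ContinuousLinearMap.coe_coe, E.eigen]

theorem effDim_eq {γ : ℝ} (hγ : 0 < γ) : effDim φ γ lam = (E.top γ).card := by
  rw [effDim, E.topSpace_eq hγ, finrank_span_eq_card, Fintype.card_coe]
  exact E.orthonormal.linearIndependent.comp _ Subtype.val_injective

theorem inner_eq_zero_of_mem_topSpace {γ : ℝ} (hγ : 0 < γ) {z : H} (hz : z ∈ topSpace φ γ lam)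
    {j : Fin E.n} (hj : j ∉ E.top γ) : ⟪E.b j, z⟫_ℝ = 0 := by
  rw [E.topSpace_eq hγ] at hz
  induction hz using Submodule.span_induction with
  | mem x hx =>
    obtain ⟨k, rfl⟩ := hx
    rw [inner_eq_ite, if_neg]
    rintro rfl
    exact hj k.2
  | zero => simp
  | add x y _ _ hx hy => rw [inner_add_right, hx, hy, add_zero]
  | smul c x _ hx => rw [real_inner_smul_right, hx, mul_zero]

end EigenCoords

/-- Provides the boundedness without which the supremum of natural numbers in `maxEffDim` would
default to zero. -/
theorem effDim_le_card (φ : α → H) (γ : ℝ) (hγ : 0 < γ) {lam : α → ℝ} :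
    effDim φ γ lam ≤ Fintype.card α := by
  have hle : topSpace φ γ lam ≤ Submodule.span ℝ (Set.range φ) := by
    refine iSup_le fun s z hz => ?_
    rw [Module.End.mem_eigenspace_iff, ContinuousLinearMap.coe_coe] at hz
    exact mem_span_range_of_eigen (hγ.trans_le s.2) hz
  have := finiteDimensional_span_range φ
  exact (Submodule.finrank_mono hle).trans (finrank_range_le_card φ)

end Coordinates

end PTRBandit

end

/-! ### Existence of PTR allocations and of optimal designs. -/

noncomputable section

namespace PTRBandit

section Existence

variable {α : Type*} [Fintype α] {H : Type*} [NormedAddCommGroup H] [InnerProductSpace ℝ H]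
  [CompleteSpace H]

theorem exists_isPTRAllocation (φ : α → H) {γ : ℝ} (hγ : 0 < γ) {V : Finset α} (hV : V.Nonempty)
    {lam : α → ℝ} (hlam : lam ∈ simplex V) {τ : ℕ} (hτ : 1 ≤ τ)
    (hdim : 64 * effDim φ γ lam ≤ τ) : ∃ a : ℕ → α, IsPTRAllocation φ γ V lam τ a := by
  obtain ⟨h0, hsupp, h1⟩ := hlam
  obtain ⟨E⟩ := nonempty_eigenCoords φ h0
  have hτ0 : (0 : ℝ) < τ := by exact_mod_cast hτ
  have hne : Nonempty V := hV.to_subtype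
  set r := ⨆ v : V, invNormSq ((τ : ℝ) • designOp φ lam) (τ * γ) (φ v) with hr
  have hcoord := E.invNormSq_eq h0 hγ hτ0
  have hrle : ∀ v ∈ V, ∑ j, E.coord v j ^ 2 / (τ * (E.d j + γ)) ≤ r := fun v hv => by
    rw [← hcoord]
    exact le_ciSup (f := fun v : V => invNormSq ((τ : ℝ) • designOp φ lam) (τ * γ) (φ v))
      (Set.finite_range _).bddAbove ⟨v, hv⟩
  have hpos : ∀ j, 0 < E.d j + γ := fun j => by have := E.d_nonneg h0 j; positivity
  have hr0 : 0 ≤ r := by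
    obtain ⟨v, hv⟩ := hV
    refine le_trans (Finset.sum_nonneg fun j _ => ?_) (hrle v hv)
    have := hpos j
    positivity
  -- The left side is `τ` times the `λ`-average of the variances, which cannot exceed their maximum.
  have htr : ∑ j, E.d j / (E.d j + γ) ≤ τ * r := by
    calc ∑ j, E.d j / (E.d j + γ)
        = τ * ∑ x, lam x * ∑ j, E.coord x j ^ 2 / (τ * (E.d j + γ)) := by
          simp only [Finset.mul_sum]
          rw [Finset.sum_comm]
          refine Finset.sum_congr rfl fun j _ => ?_
          have := (hpos j).ne'
          conv_lhs => rw [E.d_eq j, Finset.sum_div]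
          refine Finset.sum_congr rfl fun x _ => ?_
          rw [← E.d_eq j]
          field_simp
      _ ≤ τ * ∑ x, lam x * r := by
          refine mul_le_mul_of_nonneg_left (Finset.sum_le_sum fun x _ => ?_) hτ0.le
          by_cases hx : x ∈ V
          · exact mul_le_mul_of_nonneg_left (hrle x hx) (h0 x)
          · simp [hsupp x hx]
      _ = τ * r := by rw [← Finset.sum_mul, h1, one_mul]
  rw [E.effDim_eq hγ] at hdim
  -- The first `t` measurements serve the projected condition, the other `m ≥ τ / 2` the worst-case
  -- variance.
  set t := τ / 2
  set m := τ - τ / 2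
  have hm : 0 < m := by omega
  have htm : t + m = τ := by omega
  obtain ⟨s₂, hs₂, hwc⟩ := exists_selection_worst_case V hV E.coord (E.d_nonneg h0) hγ hm
    (by omega : τ ≤ 2 * m) (by omega) hdim hrle htr
  obtain ⟨s₁, hs₁, hproj⟩ : ∃ s : ℕ → α, (∀ i < t, s i ∈ V) ∧
      ∀ z : Fin E.n → ℝ, (∀ j ∉ E.top γ, z j = 0) →
        τ / 4 * ∑ j, E.d j * z j ^ 2 ≤ ∑ i ∈ Finset.range t, (E.coord (s i) ⬝ᵥ z) ^ 2 := by
    -- With an empty top space only `z = 0` is tested and any arm will do. Otherwise `τ ≥ 64`, so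
    -- rounding `τ / 2` down is harmless and `3t/4 - 4d ≥ τ/4`.
    rcases (E.top γ).eq_empty_or_nonempty with hJ | hJ
    · obtain ⟨v, hv⟩ := hV
      refine ⟨fun _ => v, fun _ _ => hv, fun z hz => ?_⟩
      have : ∑ j, E.d j * z j ^ 2 = 0 := Finset.sum_eq_zero fun j _ => by
        rw [hz j (by simp [hJ])]; ring
      rw [this, mul_zero]
      exact Finset.sum_nonneg fun i _ => sq_nonneg _
    · obtain ⟨s, hs, h⟩ := exists_selection_projected h0 h1 E.sum_coord_mul (E.top γ)
        (fun j hj => hγ.trans_le (Finset.mem_filter.1 hj).2) hJ t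
      refine ⟨s, fun i hi => by_contra fun hx => hs i hi (hsupp _ hx), fun z hz => ?_⟩
      refine le_trans ?_ (h z hz)
      have hc : 1 ≤ (E.top γ).card := hJ.card_pos
      have e1 : (1 : ℝ) ≤ (E.top γ).card := by exact_mod_cast hc
      have e2 : (64 * (E.top γ).card : ℝ) ≤ τ := by exact_mod_cast hdim
      have e3 : (τ : ℝ) ≤ 2 * t + 1 := by exact_mod_cast (by omega : τ ≤ 2 * t + 1)
      refine mul_le_mul_of_nonneg_right (by linarith) (Finset.sum_nonneg fun j _ => ?_)
      exact mul_nonneg (E.d_nonneg h0 j) (sq_nonneg _)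
  let a : ℕ → α := fun i => if i < t then s₁ i else if h : i - t < m then s₂ ⟨i - t, h⟩ else s₁ i
  have ha₁ : ∀ i < t, a i = s₁ i := fun i hi => if_pos hi
  have ha₂ : ∀ i : Fin m, a (t + i) = s₂ i := fun i => by
    simp [a]
  have hsum : ∀ g : α → ℝ, ∑ i ∈ Finset.range τ, g (a i) =
      ∑ i ∈ Finset.range t, g (s₁ i) + ∑ i, g (s₂ i) := by
    intro g
    rw [← htm, Finset.sum_range_add, Finset.sum_range fun i => g (a (t + i))]
    congr 1
    · exact Finset.sum_congr rfl fun i hi => by rw [ha₁ i (Finset.mem_range.1 hi)]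
    · exact Finset.sum_congr rfl fun i _ => by rw [ha₂]
  refine ⟨a, ⟨fun i hi => ?_, fun z hz => ?_, ?_⟩⟩
  · by_cases hit : i < t
    · rw [ha₁ i hit]; exact hs₁ i hit
    · obtain ⟨k, rfl⟩ := Nat.exists_eq_add_of_le (not_lt.1 hit)
      have : k < m := by omega
      rw [ha₂ ⟨k, this⟩]; exact hs₂ _
  · have h2 := hproj (fun j => ⟪E.b j, z⟫_ℝ) fun j hj => E.inner_eq_zero_of_mem_topSpace hγ hz hj
    rw [← inner_designOp_self, E.inner_designOp_self, hsum fun x => ⟪φ x, z⟫_ℝ ^ 2]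
    simp only [E.inner_eq]
    have h3 : 0 ≤ ∑ i, (E.coord (s₂ i) ⬝ᵥ fun j => ⟪E.b j, z⟫_ℝ) ^ 2 :=
      Finset.sum_nonneg fun i _ => sq_nonneg _
    have h4 : 0 ≤ τ * γ * ‖z‖ ^ 2 := by positivity
    linarith
  · refine ciSup_le fun v => invNormSq_le (isPositive_sampleOp φ a τ) (by positivity)
      (by positivity) fun z => ?_
    have h2 := hwc v v.2 fun j => ⟪E.b j, z⟫_ℝ
    rw [inner_sampleOp_self, hsum fun x => ⟪φ x, z⟫_ℝ ^ 2]
    simp only [E.inner_eq]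
    refine h2.trans ?_
    have h3 : 0 ≤ ∑ i ∈ Finset.range t, (E.coord (s₁ i) ⬝ᵥ fun j => ⟪E.b j, z⟫_ℝ) ^ 2 :=
      Finset.sum_nonneg fun i _ => sq_nonneg _
    have h4 : (fun j => ⟪E.b j, z⟫_ℝ) ⬝ᵥ (fun j => ⟪E.b j, z⟫_ℝ) ≤ ‖z‖ ^ 2 := by
      refine le_trans (le_of_eq ?_) (E.sum_sq_le z)
      exact Finset.sum_congr rfl fun j _ => (sq _).symm
    have h5 : τ * γ * ((fun j => ⟪E.b j, z⟫_ℝ) ⬝ᵥ (fun j => ⟪E.b j, z⟫_ℝ)) ≤ τ * γ * ‖z‖ ^ 2 := by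
      gcongr
    refine mul_le_mul_of_nonneg_left ?_ (by positivity)
    linarith

theorem isCompact_simplex (V : Finset α) : IsCompact (simplex V) := by
  classical
  have h : simplex V = stdSimplex ℝ α ∩ {lam | ∀ x, x ∉ V → lam x = 0} := by
    ext lam
    simp only [simplex, stdSimplex, Set.mem_ofPred_eq, Set.mem_inter_iff]
    tauto
  rw [h]
  refine (isCompact_stdSimplex ℝ α).inter_right ?_
  simp only [Set.ofPred_forall]
  exact isClosed_iInter fun x => isClosed_iInter fun _ =>
    isClosed_eq (continuous_apply x) continuous_const

theorem simplex_nonempty {V : Finset α} (hV : V.Nonempty) : (simplex V).Nonempty := by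
  classical
  obtain ⟨v, hv⟩ := hV
  refine ⟨Pi.single v 1, fun x => ?_, fun x hx => ?_, by simp⟩
  · by_cases h : x = v
    · subst h; simp
    · simp [h]
  · have : x ≠ v := fun h => hx (h ▸ hv)
    simp [this]

theorem continuousOn_invNormSq (φ : α → H) {γ : ℝ} (hγ : 0 < γ) (V : Finset α) (v : H) :
    ContinuousOn (fun lam => invNormSq (designOp φ lam) γ v) (simplex V) := by
  intro lam hlam
  apply ContinuousAt.continuousWithinAt
  have hcont : Continuous fun lam : α → ℝ => designOp φ lam + γ • (1 : H →L[ℝ] H) := by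
    unfold designOp
    fun_prop
  have hu := isUnit_add_smul_one (isPositive_designOp φ hlam.1) hγ
  have hinv : ContinuousAt (fun lam : α → ℝ =>
      Ring.inverse (designOp φ lam + γ • (1 : H →L[ℝ] H))) lam := by
    have := NormedRing.inverse_continuousAt hu.unit
    exact ContinuousAt.comp (g := Ring.inverse)
      (f := fun lam : α → ℝ => designOp φ lam + γ • (1 : H →L[ℝ] H)) this hcont.continuousAt
  exact ContinuousAt.inner continuousAt_const (hinv.clm_apply continuousAt_const)

/-- A finite maximum of continuous functions on a compact simplex; continuity comes from that of
inversion at units. -/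
theorem exists_optimal_design (φ : α → H) {γ : ℝ} (hγ : 0 < γ) {V : Finset α} (hV : V.Nonempty) :
    ∃ lam ∈ simplex V, ∀ lam' ∈ simplex V, designValue φ γ V lam ≤ designValue φ γ V lam' := by
  have hne : Nonempty V := hV.to_subtype
  have hcont : ContinuousOn (designValue φ γ V) (simplex V) := by
    have : designValue φ γ V = fun lam => (Finset.univ : Finset V).sup' Finset.univ_nonempty
        fun v => invNormSq (designOp φ lam) γ (φ v) := by
      ext lam
      rw [designValue, Finset.sup'_univ_eq_ciSup]
    rw [this]
    exact ContinuousOn.finset_sup'_apply Finset.univ_nonempty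
      fun v _ => continuousOn_invNormSq φ hγ V (φ v)
  obtain ⟨lam, hlam, hmin⟩ := (isCompact_simplex V).exists_isMinOn (simplex_nonempty hV) hcont
  exact ⟨lam, hlam, fun lam' h => hmin h⟩

theorem exists_isPTR [Nonempty α] (φ : α → H) {γ σ δ κ : ℝ} (hγ : 0 < γ) (hκ : 64 ≤ κ) :
    ∃ R : Rule α, R.IsPTR φ γ σ δ κ := by
  classical
  have hne : ∀ V : Finset α, 1 < V.card → V.Nonempty := fun V h => Finset.card_pos.1 (by omega)
  have hdes : ∀ V : Finset α, ∃ lam : α → ℝ, 1 < V.card → lam ∈ simplex V ∧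
      ∀ lam' ∈ simplex V, designValue φ γ V lam ≤ designValue φ γ V lam' := by
    intro V
    by_cases h : 1 < V.card
    · obtain ⟨lam, h1, h2⟩ := exists_optimal_design φ hγ (hne V h)
      exact ⟨lam, fun _ => ⟨h1, h2⟩⟩
    · exact ⟨0, fun h' => absurd h' h⟩
  choose design hdesign using hdes
  have hall : ∀ (ℓ : ℕ) (V : Finset α), ∃ a : ℕ → α, 1 < V.card →
      IsPTRAllocation φ γ V (design V) (stageLength φ γ σ δ κ ℓ V (design V)) a := by
    intro ℓ V
    by_cases h : 1 < V.card
    · obtain ⟨a, ha⟩ := exists_isPTRAllocation φ hγ (hne V h) (hdesign V h).1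
        (τ := stageLength φ γ σ δ κ ℓ V (design V)) (le_max_left _ _) (by
          refine le_max_of_le_right ?_
          have h1 : κ * effDim φ γ (design V) ≤ _ := le_trans (le_max_right _ _)
            (Nat.le_ceil (max (2 * σ ^ 2 * (eps ℓ)⁻¹ ^ 2 * optValue φ γ V *
              Real.log (4 * (ℓ : ℝ) ^ 2 * Fintype.card α / δ)) (κ * effDim φ γ (design V))))
          have h2 : (64 : ℝ) * effDim φ γ (design V) ≤ κ * effDim φ γ (design V) := by gcongr
          exact_mod_cast h2.trans h1)
      exact ⟨a, fun _ => ha⟩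
    · obtain ⟨a⟩ : Nonempty (ℕ → α) := inferInstance
      exact ⟨a, fun h' => absurd h' h⟩
  choose alloc halloc using hall
  exact ⟨⟨design, alloc⟩, fun V h => (hdesign V h).1, fun V h => (hdesign V h).2,
    fun ℓ _ V h => halloc ℓ V h⟩

end Existence

end PTRBandit

end

/-! ### Design values and the error of least squares. -/

noncomputable section

namespace PTRBandit

section Values

variable {α : Type*} [Fintype α] {H : Type*} [NormedAddCommGroup H] [InnerProductSpace ℝ H]

theorem invNormSq_le_designValue (φ : α → H) (γ : ℝ) (lam : α → ℝ) {V : Finset α} {v : α}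
    (hv : v ∈ V) : invNormSq (designOp φ lam) γ (φ v) ≤ designValue φ γ V lam :=
  le_ciSup (f := fun v : V => invNormSq (designOp φ lam) γ (φ v))
    (Set.finite_range _).bddAbove ⟨v, hv⟩

theorem optValue_le_maxOptValue (φ : α → H) (γ : ℝ) {V : Finset α} (hV : V.Nonempty) :
    optValue φ γ V ≤ maxOptValue φ γ :=
  le_ciSup (f := fun V : {V : Finset α // V.Nonempty} => optValue φ γ V)
    (Set.finite_range _).bddAbove ⟨V, hV⟩

variable [CompleteSpace H]

theorem designValue_nonneg (φ : α → H) {γ : ℝ} (hγ : 0 < γ) {V : Finset α} {lam : α → ℝ}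
    (hlam : lam ∈ simplex V) : 0 ≤ designValue φ γ V lam :=
  Real.iSup_nonneg fun v => invNormSq_nonneg (isPositive_designOp φ hlam.1) hγ (φ v)

theorem optValue_nonneg (φ : α → H) {γ : ℝ} (hγ : 0 < γ) (V : Finset α) : 0 ≤ optValue φ γ V :=
  Real.iInf_nonneg fun lam => designValue_nonneg φ hγ lam.2

theorem maxOptValue_nonneg (φ : α → H) {γ : ℝ} (hγ : 0 < γ) : 0 ≤ maxOptValue φ γ :=
  Real.iSup_nonneg fun V => optValue_nonneg φ hγ V

theorem designValue_eq_optValue (φ : α → H) {γ : ℝ} (hγ : 0 < γ) {V : Finset α} {lam : α → ℝ}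
    (hlam : lam ∈ simplex V)
    (hmin : ∀ lam' ∈ simplex V, designValue φ γ V lam ≤ designValue φ γ V lam') :
    designValue φ γ V lam = optValue φ γ V := by
  have : Nonempty (simplex V) := ⟨⟨lam, hlam⟩⟩
  refine le_antisymm (le_ciInf fun lam' => hmin lam' lam'.2) ?_
  refine ciInf_le (f := fun lam : simplex V => designValue φ γ V lam) ⟨0, ?_⟩ ⟨lam, hlam⟩
  rintro _ ⟨lam', rfl⟩
  exact designValue_nonneg φ hγ lam'.2

theorem invNormSq_smul_designOp (φ : α → H) {γ : ℝ} (hγ : 0 < γ) {lam : α → ℝ}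
    (h : ∀ x, 0 ≤ lam x) {τ : ℝ} (hτ : 0 < τ) (x : α) :
    invNormSq (τ • designOp φ lam) (τ * γ) (φ x) = invNormSq (designOp φ lam) γ (φ x) / τ := by
  obtain ⟨E⟩ := nonempty_eigenCoords φ h
  have h1 := E.invNormSq_eq h hγ one_pos x
  rw [one_smul, one_mul] at h1
  rw [h1, E.invNormSq_eq h hγ hτ, Finset.sum_div]
  refine Finset.sum_congr rfl fun j _ => ?_
  rw [one_mul, div_div, mul_comm τ]

theorem norm_sq_le_of_quad_le (φ : α → H) {γ : ℝ} (hγ : 0 < γ) {lam : α → ℝ}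
    (h : ∀ x, 0 ≤ lam x) {x : α} (hq : ⟪designOp φ lam (φ x), φ x⟫_ℝ ≤ γ * ‖φ x‖ ^ 2) :
    ‖φ x‖ ^ 2 ≤ 2 * γ * invNormSq (designOp φ lam) γ (φ x) := by
  have h1 := sq_inner_le_invNormSq_mul (isPositive_designOp φ h) hγ (φ x) (φ x)
  rw [real_inner_self_eq_norm_sq] at h1
  have h2 := invNormSq_nonneg (isPositive_designOp φ h) hγ (φ x)
  rcases (sq_nonneg ‖φ x‖).eq_or_lt with h0 | h0
  · rw [← h0]; positivity
  · have h3 : (‖φ x‖ ^ 2) ^ 2 ≤ invNormSq (designOp φ lam) γ (φ x) * (2 * γ * ‖φ x‖ ^ 2) :=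
      h1.trans (mul_le_mul_of_nonneg_left (by linarith) h2)
    nlinarith

/-- If no eigenvalue reaches `γ`, then `A(λ) ≤ γ I` on the features, and the regularised inverse is
at least `(2γ)⁻¹` there. Such stages therefore involve short features only. -/
theorem norm_sq_le_of_effDim_eq_zero (φ : α → H) {γ : ℝ} (hγ : 0 < γ) {lam : α → ℝ}
    (h : ∀ x, 0 ≤ lam x) (hdim : effDim φ γ lam = 0) (x : α) :
    ‖φ x‖ ^ 2 ≤ 2 * γ * invNormSq (designOp φ lam) γ (φ x) := by
  obtain ⟨E⟩ := nonempty_eigenCoords φ h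
  refine norm_sq_le_of_quad_le φ hγ h ?_
  rw [E.effDim_eq hγ, Finset.card_eq_zero] at hdim
  have hlt : ∀ j, E.d j ≤ γ := fun j => by
    by_contra! hj
    have : j ∈ E.top γ := Finset.mem_filter.2 ⟨Finset.mem_univ _, hj.le⟩
    simp [hdim] at this
  rw [E.inner_designOp_self, E.norm_sq_eq, Finset.mul_sum]
  exact Finset.sum_le_sum fun j _ => mul_le_mul_of_nonneg_right (hlt j) (sq_nonneg _)

/-- On a singleton the only design is a point mass, of value `p / (p + γ)` with `p = ‖φ x‖²`. This
is what lets a bare `h` be absorbed into `√F h`. -/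
theorem half_le_maxOptValue (φ : α → H) {γ : ℝ} (hγ : 0 < γ) {x : α} (hx : γ ≤ ‖φ x‖ ^ 2) :
    1 / 2 ≤ maxOptValue φ γ := by
  refine le_trans ?_ (optValue_le_maxOptValue φ γ (Finset.singleton_nonempty x))
  have : Nonempty (simplex ({x} : Finset α)) :=
    (simplex_nonempty (Finset.singleton_nonempty x)).to_subtype
  refine le_ciInf fun lam => ?_
  refine le_trans ?_ (invNormSq_le_designValue φ γ lam (Finset.mem_singleton_self x))
  obtain ⟨lam, h0, hsupp, h1⟩ := lam
  have hle : ⟪designOp φ lam (φ x), φ x⟫_ℝ ≤ (‖φ x‖ ^ 2) ^ 2 := by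
    rw [inner_designOp_self, Finset.sum_eq_single x
      (fun y _ hy => by rw [hsupp y (by simpa using hy), zero_mul]) (by simp),
      real_inner_self_eq_norm_sq]
    have : lam x ≤ 1 := by
      rw [← h1]; exact Finset.single_le_sum (fun y _ => h0 y) (Finset.mem_univ x)
    have := mul_le_mul_of_nonneg_right this (sq_nonneg (‖φ x‖ ^ 2))
    linarith
  have h2 := sq_inner_le_invNormSq_mul (isPositive_designOp φ h0) hγ (φ x) (φ x)
  have h3 := invNormSq_nonneg (isPositive_designOp φ h0) hγ (φ x)
  rw [real_inner_self_eq_norm_sq] at h2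
  change 1 / 2 ≤ invNormSq (designOp φ lam) γ (φ x)
  set p := ‖φ x‖ ^ 2
  have hp : 0 < p := hγ.trans_le hx
  have h4 : p ^ 2 ≤ invNormSq (designOp φ lam) γ (φ x) * (2 * p ^ 2) :=
    h2.trans (mul_le_mul_of_nonneg_left (by nlinarith) h3)
  have : 0 < p ^ 2 := by positivity
  nlinarith

end Values

section Estimation

variable {α : Type*} [Fintype α] {H : Type*} [NormedAddCommGroup H] [InnerProductSpace ℝ H]

/-- The coefficient of the `i`-th reward in the least squares prediction at the arm `x`. -/
def predWeight {α : Type*} (φ : α → H) (γ : ℝ) (a : ℕ → α) (τ : ℕ) (x : α) (i : ℕ) : ℝ :=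
  ⟪φ x, Ring.inverse (sampleOp φ a τ + (τ * γ : ℝ) • (1 : H →L[ℝ] H)) (φ (a i))⟫_ℝ

theorem inner_estimate {α : Type*} (φ : α → H) (γ : ℝ) (μ : α → ℝ) (ξ : ℕ → ℝ) (a : ℕ → α)
    (τ s : ℕ) (x : α) : ⟪φ x, estimate φ γ μ ξ a τ s⟫_ℝ =
      ∑ i ∈ Finset.range τ, (μ (a i) + ξ (s + i)) * predWeight φ γ a τ x i := by
  rw [estimate, map_sum, inner_sum]
  exact Finset.sum_congr rfl fun i _ => by rw [map_smul, real_inner_smul_right]; rfl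

variable [CompleteSpace H]

theorem sum_predWeight_sq_le {α : Type*} (φ : α → H) {γ : ℝ} (hγ : 0 < γ) (a : ℕ → α) {τ : ℕ}
    (hτ : 0 < τ) (x : α) :
    ∑ i ∈ Finset.range τ, predWeight φ γ a τ x i ^ 2 ≤
      invNormSq (sampleOp φ a τ) (τ * γ) (φ x) := by
  have hτ0 : (0 : ℝ) < τ := by exact_mod_cast hτ
  have hS := isPositive_sampleOp φ a τ
  have hr : 0 < τ * γ := by positivity
  rw [invNormSq_eq hS hr, inner_sampleOp_self]
  refine le_trans (le_of_eq ?_) (le_add_of_nonneg_right (by positivity))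
  refine Finset.sum_congr rfl fun i _ => ?_
  rw [predWeight, ← inner_inverse_comm hS hr, real_inner_comm]

/-- The error of the least squares prediction: noise plus a bias that is controlled by the
regularisation and by the misspecification. -/
theorem abs_inner_estimate_sub_le {α : Type*} (φ : α → H) {γ : ℝ} (hγ : 0 < γ) (μ : α → ℝ)
    (ξ : ℕ → ℝ) (a : ℕ → α) {τ : ℕ} (hτ : 0 < τ) (s : ℕ) (x : α) {θ : H} {h f : ℝ} (hh : 0 ≤ h)
    (hμ : ∀ x, |μ x - ⟪θ, φ x⟫_ℝ| ≤ h) (hf0 : 0 ≤ f)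
    (hf : invNormSq (sampleOp φ a τ) (τ * γ) (φ x) ≤ 4 * f / τ) :
    |⟪φ x, estimate φ γ μ ξ a τ s⟫_ℝ - ⟪φ x, θ⟫_ℝ| ≤ 2 * √f * (√γ * ‖θ‖ + h) +
      |∑ i ∈ Finset.range τ, ξ (s + i) * predWeight φ γ a τ x i| := by
  have hτ0 : (0 : ℝ) < τ := by exact_mod_cast hτ
  have hS := isPositive_sampleOp φ a τ
  have hr : 0 < τ * γ := by positivity
  set y := Ring.inverse (sampleOp φ a τ + (τ * γ : ℝ) • (1 : H →L[ℝ] H)) (φ x) with hy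
  have hw : ∀ i, predWeight φ γ a τ x i = ⟪φ (a i), y⟫_ℝ := fun i => by
    rw [predWeight, ← inner_inverse_comm hS hr, real_inner_comm]
  have hθ : ⟪φ x, θ⟫_ℝ =
      ∑ i ∈ Finset.range τ, ⟪θ, φ (a i)⟫_ℝ * predWeight φ γ a τ x i + τ * γ * ⟪y, θ⟫_ℝ := by
    conv_lhs => rw [← add_smul_one_apply_inverse hS hr (φ x)]
    rw [← hy, inner_add_left, real_inner_smul_left, sampleOp_apply, sum_inner]
    congr 1
    refine Finset.sum_congr rfl fun i _ => ?_
    rw [real_inner_smul_left, hw, real_inner_comm (φ (a i)) θ]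
    ring
  -- Misspecification, regularisation and noise; the first two are bounded by Cauchy–Schwarz from
  -- the single variance bound `4f / τ`.
  have hdec : ⟪φ x, estimate φ γ μ ξ a τ s⟫_ℝ - ⟪φ x, θ⟫_ℝ =
      ∑ i ∈ Finset.range τ, (μ (a i) - ⟪θ, φ (a i)⟫_ℝ) * predWeight φ γ a τ x i
        - τ * γ * ⟪y, θ⟫_ℝ + ∑ i ∈ Finset.range τ, ξ (s + i) * predWeight φ γ a τ x i := by
    rw [inner_estimate, hθ]
    simp only [add_mul, sub_mul, Finset.sum_add_distrib, Finset.sum_sub_distrib]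
    ring
  have hsq := sum_predWeight_sq_le φ hγ a hτ x
  have hmis : |∑ i ∈ Finset.range τ, (μ (a i) - ⟪θ, φ (a i)⟫_ℝ) * predWeight φ γ a τ x i| ≤
      2 * √f * h := by
    apply abs_le_of_sq_le_sq _ (by positivity)
    calc _ ≤ (∑ i ∈ Finset.range τ, (μ (a i) - ⟪θ, φ (a i)⟫_ℝ) ^ 2) *
          ∑ i ∈ Finset.range τ, predWeight φ γ a τ x i ^ 2 := Finset.sum_mul_sq_le_sq_mul_sq _ _ _
      _ ≤ (∑ _i ∈ Finset.range τ, h ^ 2) * (4 * f / τ) := by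
          refine mul_le_mul (Finset.sum_le_sum fun i _ => ?_) (hsq.trans hf)
            (Finset.sum_nonneg fun i _ => sq_nonneg _) (Finset.sum_nonneg fun i _ => sq_nonneg _)
          exact sq_le_sq' (by linarith [(abs_le.1 (hμ (a i))).1]) (abs_le.1 (hμ (a i))).2
      _ = (2 * √f * h) ^ 2 := by
          rw [Finset.sum_const, Finset.card_range, nsmul_eq_mul, mul_pow, mul_pow,
            Real.sq_sqrt hf0]
          field_simp
          ring
  have hreg : |τ * γ * ⟪y, θ⟫_ℝ| ≤ 2 * √f * (√γ * ‖θ‖) := by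
    have h1 : τ * γ * ‖y‖ ^ 2 ≤ 4 * f / τ := by
      refine le_trans ?_ hf
      rw [invNormSq_eq hS hr]
      exact le_add_of_nonneg_left (hS.inner_nonneg_left _)
    have h2 : τ * γ * ‖y‖ ≤ 2 * √f * √γ := by
      apply le_of_sq_le_sq _ (by positivity)
      rw [mul_pow (τ * γ : ℝ), mul_pow (2 * √f), mul_pow 2, Real.sq_sqrt hf0, Real.sq_sqrt hγ.le]
      calc (τ * γ) ^ 2 * ‖y‖ ^ 2 = τ * γ * (τ * γ * ‖y‖ ^ 2) := by ring
        _ ≤ τ * γ * (4 * f / τ) := by gcongr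
        _ = 2 ^ 2 * f * γ := by field_simp; ring
    rw [abs_mul, abs_of_pos hr]
    calc τ * γ * |⟪y, θ⟫_ℝ| ≤ τ * γ * (‖y‖ * ‖θ‖) := by
          gcongr; exact abs_real_inner_le_norm y θ
      _ = τ * γ * ‖y‖ * ‖θ‖ := by ring
      _ ≤ 2 * √f * √γ * ‖θ‖ := by gcongr
      _ = _ := by ring
  rw [hdec]
  refine (abs_add_le _ _).trans ?_
  have := abs_sub (∑ i ∈ Finset.range τ, (μ (a i) - ⟪θ, φ (a i)⟫_ℝ) * predWeight φ γ a τ x i)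
    (τ * γ * ⟪y, θ⟫_ℝ)
  linarith

/-- Combines the worst-case rounding with the minimality of the design: the factor `τ` scales out of
the regularised inverse and the maximum over `V` is `f(V, γ)`. -/
theorem invNormSq_sampleOp_le {φ : α → H} {γ : ℝ} (hγ : 0 < γ) {V : Finset α} {lam : α → ℝ}
    (hlam : lam ∈ simplex V)
    (hmin : ∀ lam' ∈ simplex V, designValue φ γ V lam ≤ designValue φ γ V lam') {τ : ℕ}
    (hτ : 0 < τ) {a : ℕ → α} (ha : IsPTRAllocation φ γ V lam τ a) {x : α} (hx : x ∈ V) :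
    invNormSq (sampleOp φ a τ) (τ * γ) (φ x) ≤ 4 * optValue φ γ V / τ := by
  have hτ0 : (0 : ℝ) < τ := by exact_mod_cast hτ
  have : Nonempty V := ⟨⟨x, hx⟩⟩
  have h1 : invNormSq (sampleOp φ a τ) (τ * γ) (φ x) ≤
      ⨆ v : V, invNormSq (sampleOp φ a τ) (τ * γ) (φ v) :=
    le_ciSup (f := fun v : V => invNormSq (sampleOp φ a τ) (τ * γ) (φ v))
      (Set.finite_range _).bddAbove ⟨x, hx⟩
  refine (h1.trans ha.full).trans ?_
  rw [mul_div_assoc]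
  refine mul_le_mul_of_nonneg_left (ciSup_le fun v => ?_) (by norm_num)
  rw [invNormSq_smul_designOp φ hγ hlam.1 hτ0, ← designValue_eq_optValue φ hγ hlam hmin]
  gcongr
  exact invNormSq_le_designValue φ γ lam v.2

end Estimation

end PTRBandit

end

/-! ### Elimination, stages and gaps. -/

noncomputable section

namespace PTRBandit

section Elimination

theorem eps_pos (ℓ : ℕ) : 0 < eps ℓ := by unfold eps; positivity

theorem eps_succ (ℓ : ℕ) : eps (ℓ + 1) = eps ℓ / 2 := by unfold eps; rw [pow_succ]; ring

variable {α : Type*} [Fintype α] {H : Type*} [NormedAddCommGroup H] [InnerProductSpace ℝ H]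

theorem mem_survivors {φ : α → H} {ℓ : ℕ} {V : Finset α} {θ : H} {x : α} :
    x ∈ survivors φ ℓ V θ ↔ x ∈ V ∧ ∀ x' ∈ V, ⟪φ x', θ⟫_ℝ - ⟪φ x, θ⟫_ℝ < 8 * eps ℓ := by
  classical
  simp [survivors, inner_sub_left]

theorem survivors_subset (φ : α → H) (ℓ : ℕ) (V : Finset α) (θ : H) : survivors φ ℓ V θ ⊆ V :=
  fun _ hx => (mem_survivors.1 hx).1

theorem survivors_nonempty (φ : α → H) (ℓ : ℕ) {V : Finset α} (hV : V.Nonempty) (θ : H) :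
    (survivors φ ℓ V θ).Nonempty := by
  obtain ⟨x, hx, hmax⟩ := V.exists_max_image (fun x => ⟪φ x, θ⟫_ℝ) hV
  refine ⟨x, mem_survivors.2 ⟨hx, fun x' hx' => ?_⟩⟩
  have := hmax x' hx'
  have := eps_pos ℓ
  linarith

/-- If all predictions on `V` are accurate enough, the best arm survives. -/
theorem best_mem_survivors {φ : α → H} {ℓ : ℕ} {V : Finset α} {θ : H} {μ : α → ℝ} {ρ : ℝ}
    (hacc : ∀ x ∈ V, |⟪φ x, θ⟫_ℝ - μ x| ≤ ρ + 2 * eps ℓ) (hρ : ρ < 2 * eps ℓ) {x₀ : α}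
    (hx₀ : x₀ ∈ V) (hbest : ∀ x, μ x ≤ μ x₀) : x₀ ∈ survivors φ ℓ V θ := by
  refine mem_survivors.2 ⟨hx₀, fun x hx => ?_⟩
  have h1 := (abs_le.1 (hacc x hx)).2
  have h2 := (abs_le.1 (hacc x₀ hx₀)).1
  have := hbest x
  linarith

/-- Each prediction is off by less than `4ε`, so two of them add `8ε` to the threshold `8ε`. -/
theorem gap_le_of_mem_survivors {φ : α → H} {ℓ : ℕ} {V : Finset α} {θ : H} {μ : α → ℝ} {ρ : ℝ}
    (hacc : ∀ x ∈ V, |⟪φ x, θ⟫_ℝ - μ x| ≤ ρ + 2 * eps ℓ) (hρ : ρ < 2 * eps ℓ) {x₀ x : α}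
    (hx₀ : x₀ ∈ V) (hx : x ∈ survivors φ ℓ V θ) : μ x₀ - μ x ≤ 16 * eps ℓ := by
  obtain ⟨hxV, hs⟩ := mem_survivors.1 hx
  have h1 := (abs_le.1 (hacc x hxV)).2
  have h2 := (abs_le.1 (hacc x₀ hx₀)).1
  have := hs x₀ hx₀
  linarith

end Elimination

section Stages

variable {α : Type*} [Fintype α] {H : Type*} [NormedAddCommGroup H] [InnerProductSpace ℝ H]

theorem Rule.one_le_len (R : Rule α) (φ : α → H) (γ σ δ κ : ℝ) (ℓ : ℕ) (V : Finset α) :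
    1 ≤ R.len φ γ σ δ κ ℓ V := le_max_left _ _

variable (R : Rule α) (φ : α → H) (γ σ δ κ : ℝ) (μ : α → ℝ) (ξ : ℕ → ℝ)

theorem stage_succ_of_one_lt {j : ℕ} (h : 1 < (stage R φ γ σ δ κ μ ξ j).1.card) :
    stage R φ γ σ δ κ μ ξ (j + 1) =
      (survivors φ (j + 1) (stage R φ γ σ δ κ μ ξ j).1 (estimate φ γ μ ξ
          (R.alloc (j + 1) (stage R φ γ σ δ κ μ ξ j).1)
          (R.len φ γ σ δ κ (j + 1) (stage R φ γ σ δ κ μ ξ j).1) (stage R φ γ σ δ κ μ ξ j).2),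
        (stage R φ γ σ δ κ μ ξ j).2 + R.len φ γ σ δ κ (j + 1) (stage R φ γ σ δ κ μ ξ j).1) := by
  rw [stage]; exact if_pos h

theorem stage_succ_of_not_one_lt {j : ℕ} (h : ¬ 1 < (stage R φ γ σ δ κ μ ξ j).1.card) :
    stage R φ γ σ δ κ μ ξ (j + 1) =
      ((stage R φ γ σ δ κ μ ξ j).1, (stage R φ γ σ δ κ μ ξ j).2 + 1) := by
  rw [stage]; exact if_neg h

theorem stage_nonempty [Nonempty α] (j : ℕ) : (stage R φ γ σ δ κ μ ξ j).1.Nonempty := by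
  induction j with
  | zero => exact Finset.univ_nonempty
  | succ j ih =>
    by_cases h : 1 < (stage R φ γ σ δ κ μ ξ j).1.card
    · rw [stage_succ_of_one_lt R φ γ σ δ κ μ ξ h]
      exact survivors_nonempty φ _ ih _
    · rw [stage_succ_of_not_one_lt R φ γ σ δ κ μ ξ h]
      exact ih

theorem stage_start_lt_succ (j : ℕ) :
    (stage R φ γ σ δ κ μ ξ j).2 < (stage R φ γ σ δ κ μ ξ (j + 1)).2 := by
  by_cases h : 1 < (stage R φ γ σ δ κ μ ξ j).1.card
  · rw [stage_succ_of_one_lt R φ γ σ δ κ μ ξ h]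
    have := R.one_le_len φ γ σ δ κ (j + 1) (stage R φ γ σ δ κ μ ξ j).1
    simp only
    omega
  · rw [stage_succ_of_not_one_lt R φ γ σ δ κ μ ξ h]
    simp

theorem le_stage_start (j : ℕ) : j ≤ (stage R φ γ σ δ κ μ ξ j).2 :=
  (strictMono_nat_of_lt_succ (stage_start_lt_succ R φ γ σ δ κ μ ξ)).le_apply

theorem stage_start_stageAt_le (t : ℕ) :
    (stage R φ γ σ δ κ μ ξ (stageAt R φ γ σ δ κ μ ξ t)).2 ≤ t :=
  Nat.findGreatest_spec (P := fun j => (stage R φ γ σ δ κ μ ξ j).2 ≤ t) (Nat.zero_le t)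
    (by simp [stage])

/-- Stage indices never exceed starting times, so the search bound `t` in `stageAt` excludes no
stage begun by time `t`. -/
theorem lt_stage_start_succ_stageAt (t : ℕ) :
    t < (stage R φ γ σ δ κ μ ξ (stageAt R φ γ σ δ κ μ ξ t + 1)).2 := by
  by_contra! h
  have h1 : stageAt R φ γ σ δ κ μ ξ t + 1 ≤ t :=
    (le_stage_start R φ γ σ δ κ μ ξ _).trans h
  have := Nat.le_findGreatest (P := fun j => (stage R φ γ σ δ κ μ ξ j).2 ≤ t) h1 h
  change _ ≤ stageAt R φ γ σ δ κ μ ξ t at this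
  omega

theorem stageAt_le (t : ℕ) : stageAt R φ γ σ δ κ μ ξ t ≤ t := Nat.findGreatest_le t

/-- At most `len` plays belong to an elimination stage. -/
theorem card_stageAt_eq_le {j : ℕ} (h : 1 < (stage R φ γ σ δ κ μ ξ j).1.card) (T : ℕ) :
    ((Finset.range T).filter fun t => stageAt R φ γ σ δ κ μ ξ t = j).card ≤
      R.len φ γ σ δ κ (j + 1) (stage R φ γ σ δ κ μ ξ j).1 := by
  have hsub : ((Finset.range T).filter fun t => stageAt R φ γ σ δ κ μ ξ t = j) ⊆
      Finset.Ico (stage R φ γ σ δ κ μ ξ j).2 (stage R φ γ σ δ κ μ ξ (j + 1)).2 := by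
    intro t ht
    obtain ⟨-, rfl⟩ := Finset.mem_filter.1 ht
    exact Finset.mem_Ico.2 ⟨stage_start_stageAt_le R φ γ σ δ κ μ ξ t,
      lt_stage_start_succ_stageAt R φ γ σ δ κ μ ξ t⟩
  refine (Finset.card_le_card hsub).trans ?_
  rw [Nat.card_Ico, stage_succ_of_one_lt R φ γ σ δ κ μ ξ h]
  simp

theorem action_mem_stage [Nonempty α] (hR : R.IsPTR φ γ σ δ κ) (t : ℕ) :
    action R φ γ σ δ κ μ ξ t ∈ (stage R φ γ σ δ κ μ ξ (stageAt R φ γ σ δ κ μ ξ t)).1 := by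
  unfold action
  simp only
  split_ifs with h h'
  · refine (hR.alloc_ptr _ (by omega) _ h).mem _ ?_
    have h1 := lt_stage_start_succ_stageAt R φ γ σ δ κ μ ξ t
    rw [stage_succ_of_one_lt R φ γ σ δ κ μ ξ h] at h1
    have h2 := R.one_le_len φ γ σ δ κ (stageAt R φ γ σ δ κ μ ξ t + 1)
      (stage R φ γ σ δ κ μ ξ (stageAt R φ γ σ δ κ μ ξ t)).1
    simp only at h1
    omega
  · exact h'.choose_spec
  · exact absurd (stage_nonempty R φ γ σ δ κ μ ξ _) h'

/-- In stage `j + 1` the noise moves no prediction by more than `2 ε`. -/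
def NoiseSmall (j : ℕ) : Prop :=
  1 < (stage R φ γ σ δ κ μ ξ j).1.card → ∀ x ∈ (stage R φ γ σ δ κ μ ξ j).1,
    |∑ i ∈ Finset.range (R.len φ γ σ δ κ (j + 1) (stage R φ γ σ δ κ μ ξ j).1),
      ξ ((stage R φ γ σ δ κ μ ξ j).2 + i) *
        predWeight φ γ (R.alloc (j + 1) (stage R φ γ σ δ κ μ ξ j).1)
          (R.len φ γ σ δ κ (j + 1) (stage R φ γ σ δ κ μ ξ j).1) x i| ≤ 2 * eps (j + 1)

variable {R φ γ σ δ κ μ ξ}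

section Gap

/-- The bias of the predictions of all stages. -/
def bias (φ : α → H) (γ : ℝ) (θ : H) (h : ℝ) : ℝ :=
  2 * √(maxOptValue φ γ) * (√γ * ‖θ‖ + h) + h

theorem bias_nonneg (φ : α → H) (γ : ℝ) (θ : H) {h : ℝ} (hh : 0 ≤ h) : 0 ≤ bias φ γ θ h := by
  unfold bias; positivity

variable [CompleteSpace H]

theorem prediction_accurate [Nonempty α] (hγ : 0 < γ) (hR : R.IsPTR φ γ σ δ κ) {θ : H} {h : ℝ}
    (hh : 0 ≤ h) (hμ : ∀ x, |μ x - ⟪θ, φ x⟫_ℝ| ≤ h) {j : ℕ}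
    (hgood : NoiseSmall R φ γ σ δ κ μ ξ j) (hcard : 1 < (stage R φ γ σ δ κ μ ξ j).1.card)
    {x : α} (hx : x ∈ (stage R φ γ σ δ κ μ ξ j).1) :
    |⟪φ x, estimate φ γ μ ξ (R.alloc (j + 1) (stage R φ γ σ δ κ μ ξ j).1)
          (R.len φ γ σ δ κ (j + 1) (stage R φ γ σ δ κ μ ξ j).1)
          (stage R φ γ σ δ κ μ ξ j).2⟫_ℝ - μ x| ≤ bias φ γ θ h + 2 * eps (j + 1) := by
  have hn := hgood hcard x hx
  set V := (stage R φ γ σ δ κ μ ξ j).1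
  have hVne : V.Nonempty := ⟨x, hx⟩
  have hlen := R.one_le_len φ γ σ δ κ (j + 1) V
  have h1 := abs_inner_estimate_sub_le φ hγ μ ξ (R.alloc (j + 1) V) hlen
    (stage R φ γ σ δ κ μ ξ j).2 x hh hμ (optValue_nonneg φ hγ V)
    (invNormSq_sampleOp_le hγ (hR.design_mem V hcard) (hR.design_min V hcard) hlen
      (hR.alloc_ptr (j + 1) (by omega) V hcard) hx)
  have h2 : 2 * √(optValue φ γ V) * (√γ * ‖θ‖ + h) ≤
      2 * √(maxOptValue φ γ) * (√γ * ‖θ‖ + h) := by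
    have := optValue_le_maxOptValue φ γ hVne
    gcongr
  have h3 := hμ x
  rw [real_inner_comm, abs_sub_comm] at h3
  have h4 := abs_sub_le ⟪φ x, estimate φ γ μ ξ (R.alloc (j + 1) V)
    (R.len φ γ σ δ κ (j + 1) V) (stage R φ γ σ δ κ μ ξ j).2⟫_ℝ ⟪φ x, θ⟫_ℝ (μ x)
  unfold bias
  linarith

/-- Either the best arm is active and the gaps are of the order of the accuracy of the stage, or
all gaps are of the order of the bias. -/
theorem gap_invariant [Nonempty α] (hγ : 0 < γ) (hR : R.IsPTR φ γ σ δ κ) {θ : H} {h B : ℝ}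
    (hh : 0 ≤ h) (hμ : ∀ x, |μ x - ⟪θ, φ x⟫_ℝ| ≤ h) (hB : ∀ x, |μ x| ≤ B)
    (hgood : ∀ j, NoiseSmall R φ γ σ δ κ μ ξ j) {x₀ : α} (hbest : ∀ x, μ x ≤ μ x₀) (j : ℕ) :
    (x₀ ∈ (stage R φ γ σ δ κ μ ξ j).1 ∧ ∀ x ∈ (stage R φ γ σ δ κ μ ξ j).1,
      μ x₀ - μ x ≤ 32 * max 1 B * eps (j + 1)) ∨
    ∀ x ∈ (stage R φ γ σ δ κ μ ξ j).1, μ x₀ - μ x ≤ 16 * max 1 B * bias φ γ θ h := by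
  have hB1 : 1 ≤ max 1 B := le_max_left _ _
  induction j with
  | zero =>
    -- Initially all gaps are at most `2B`; the factor `max 1 B` is needed for this start.
    refine Or.inl ⟨Finset.mem_univ _, fun x _ => ?_⟩
    have h1 := (abs_le.1 (hB x)).1
    have h2 := (abs_le.1 (hB x₀)).2
    have h3 : B ≤ max 1 B := le_max_right _ _
    have h4 : eps (0 + 1) = 1 / 2 := by simp [eps]
    rw [h4]
    linarith
  | succ j ih =>
    by_cases hcard : 1 < (stage R φ γ σ δ κ μ ξ j).1.card
    · have hacc := fun x (hx : x ∈ (stage R φ γ σ δ κ μ ξ j).1) =>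
        prediction_accurate hγ hR hh hμ (hgood j) hcard hx
      rw [stage_succ_of_one_lt R φ γ σ δ κ μ ξ hcard]
      rcases ih with ⟨hmem, hgap⟩ | hgap
      · by_cases hρ : bias φ γ θ h < 2 * eps (j + 1)
        · refine Or.inl ⟨best_mem_survivors hacc hρ hmem hbest, fun x hx => ?_⟩
          refine (gap_le_of_mem_survivors hacc hρ hmem hx).trans ?_
          rw [eps_succ (j + 1)]
          have := eps_pos (j + 1)
          nlinarith
        -- The bias has reached `2ε`, so the current gaps, at most `32 max(1, B) ε`, are already of
        -- its order. The best arm may be lost from here on.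
        · refine Or.inr fun x hx => (hgap x (survivors_subset _ _ _ _ hx)).trans ?_
          push Not at hρ
          nlinarith
      · exact Or.inr fun x hx => hgap x (survivors_subset _ _ _ _ hx)
    · rw [stage_succ_of_not_one_lt R φ γ σ δ κ μ ξ hcard]
      rcases ih with ⟨hmem, -⟩ | hgap
      · refine Or.inl ⟨hmem, fun x hx => ?_⟩
        have : x = x₀ := Finset.card_le_one.1 (not_lt.1 hcard) x hx x₀ hmem
        rw [this, sub_self]
        have := eps_pos (j + 1 + 1)
        positivity
      · exact Or.inr hgap

open Classical in
/-- Only the elimination stages with a positive effective dimension contribute beyond the bias. -/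
theorem gap_le [Nonempty α] (hγ : 0 < γ) (hR : R.IsPTR φ γ σ δ κ) {θ : H} {h B : ℝ}
    (hh : 0 ≤ h) (hμ : ∀ x, |μ x - ⟪θ, φ x⟫_ℝ| ≤ h) (hB : ∀ x, |μ x| ≤ B)
    (hgood : ∀ j, NoiseSmall R φ γ σ δ κ μ ξ j) {x₀ : α} (hbest : ∀ x, μ x ≤ μ x₀) {j : ℕ}
    {x : α} (hx : x ∈ (stage R φ γ σ δ κ μ ξ j).1) :
    μ x₀ - μ x ≤ 16 * max 1 B * bias φ γ θ h +
      if 1 < (stage R φ γ σ δ κ μ ξ j).1.card ∧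
        effDim φ γ (R.design (stage R φ γ σ δ κ μ ξ j).1) ≠ 0
      then 32 * max 1 B * eps (j + 1) else 0 := by
  have hB1 : 1 ≤ max 1 B := le_max_left _ _
  have hb := bias_nonneg φ γ θ hh
  have heps := eps_pos (j + 1)
  rcases gap_invariant hγ hR hh hμ hB hgood hbest j with ⟨hmem, hgap⟩ | hgap
  · split_ifs with hcase
    · have := hgap x hx
      have : 0 ≤ 16 * max 1 B * bias φ γ θ h := by positivity
      linarith
    · rw [add_zero]
      by_cases hcard : 1 < (stage R φ γ σ δ κ μ ξ j).1.card
      · have hdim : effDim φ γ (R.design (stage R φ γ σ δ κ μ ξ j).1) = 0 := by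
          by_contra h0; exact hcase ⟨hcard, h0⟩
        set V := (stage R φ γ σ δ κ μ ξ j).1
        set F := maxOptValue φ γ
        -- All active features are short, so every mean is within `h + 2 ‖θ‖ √(γ F)` of zero and the
        -- gaps are of the order of the bias, however large `ε` is.
        have hnorm : ∀ y ∈ V, ‖φ y‖ ≤ 2 * (√γ * √F) := by
          intro y hy
          have h1 := norm_sq_le_of_effDim_eq_zero φ hγ (hR.design_mem V hcard).1 hdim y
          have h2 : invNormSq (designOp φ (R.design V)) γ (φ y) ≤ F := by
            refine (invNormSq_le_designValue φ γ (R.design V) hy).trans ?_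
            rw [designValue_eq_optValue φ hγ (hR.design_mem V hcard) (hR.design_min V hcard)]
            exact optValue_le_maxOptValue φ γ ⟨y, hy⟩
          have hF : 0 ≤ F := maxOptValue_nonneg φ hγ
          apply le_of_sq_le_sq _ (by positivity)
          rw [mul_pow, mul_pow, Real.sq_sqrt hγ.le, Real.sq_sqrt hF]
          nlinarith [mul_le_mul_of_nonneg_left h2 hγ.le, mul_nonneg hγ.le hF]
        have h1 := (abs_le.1 (hμ x)).1
        have h2 := (abs_le.1 (hμ x₀)).2
        have h3 := (abs_le.1 ((abs_real_inner_le_norm θ (φ x)).trans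
          (mul_le_mul_of_nonneg_left (hnorm x hx) (norm_nonneg θ)))).1
        have h4 := (abs_le.1 ((abs_real_inner_le_norm θ (φ x₀)).trans
          (mul_le_mul_of_nonneg_left (hnorm x₀ hmem) (norm_nonneg θ)))).2
        have h5 : 0 ≤ √F * h := by positivity
        have h6 : bias φ γ θ h = 2 * √F * (√γ * ‖θ‖ + h) + h := rfl
        have h7 : 0 ≤ ‖θ‖ * (√γ * √F) := by positivity
        have h8 : μ x₀ - μ x ≤ 16 * bias φ γ θ h := by rw [h6]; nlinarith
        nlinarith
      · have : x = x₀ := Finset.card_le_one.1 (not_lt.1 hcard) x hx x₀ hmem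
        rw [this, sub_self]
        positivity
  · have := hgap x hx
    split_ifs
    · have : 0 ≤ 32 * max 1 B * eps (j + 1) := by positivity
      linarith
    · linarith

end Gap

end Stages

end PTRBandit

end

/-! ### Summation over stages and the deterministic regret bound. -/

noncomputable section

namespace PTRBandit

section Summation

theorem eps_eq_inv (ℓ : ℕ) : eps ℓ = ((2 : ℝ) ^ ℓ)⁻¹ := by
  unfold eps; rw [one_div, inv_pow]

theorem sum_eps_succ_le_one (N : ℕ) : ∑ j ∈ Finset.range N, eps (j + 1) ≤ 1 := by
  have h : ∑ j ∈ Finset.range N, eps (j + 1) = 1 - eps N := by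
    induction N with
    | zero => simp [eps]
    | succ N ih => rw [Finset.sum_range_succ, ih, eps_succ]; ring
  have := eps_pos N
  linarith

theorem sum_two_pow_le {w : ℝ} (hw : 0 ≤ w) (N : ℕ) :
    ∑ j ∈ Finset.range N, (if (2 : ℝ) ^ (j + 1) ≤ w then (2 : ℝ) ^ (j + 1) else 0) ≤ 2 * w := by
  have h : ∑ j ∈ Finset.range N, (if (2 : ℝ) ^ (j + 1) ≤ w then (2 : ℝ) ^ (j + 1) else 0) ≤
      min (2 * w) ((2 : ℝ) ^ (N + 1)) := by
    induction N with
    | zero => simp [hw]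
    | succ N ih =>
      rw [Finset.sum_range_succ]
      have h1 := ih.trans (min_le_left _ _)
      have h2 := ih.trans (min_le_right _ _)
      have h3 : (2 : ℝ) ^ (N + 1 + 1) = 2 * 2 ^ (N + 1) := by rw [pow_succ]; ring
      have h4 : (0 : ℝ) < 2 ^ (N + 1) := by positivity
      split_ifs with hc
      · exact le_min (by linarith) (by linarith)
      · exact le_min (by linarith) (by linarith)
  exact h.trans (min_le_left _ _)

open Classical in
/-- The total accuracy of the flagged stages `J t`, when stage `j` is visited at most
`K D + q j` times. -/
theorem sum_eps_stages_le {T : ℕ} (hT : 0 < T) {J : ℕ → ℕ} (hJ : ∀ t < T, J t < T)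
    {flag : ℕ → Prop} {K D y : ℝ} (hK : 0 ≤ K) (hD0 : 0 ≤ D) (hy : 0 ≤ y)
    (hD : ∀ t < T, flag (J t) → 1 ≤ D) {q : ℕ → ℝ}
    (hn : ∀ t < T, flag (J t) →
      (((Finset.range T).filter fun t' => J t' = J t).card : ℝ) ≤ K * D + q (J t))
    (hq : ∀ j, (2 : ℝ) ^ (j + 1) ≤ T → q j * eps (j + 1) ≤ 18 * y * 2 ^ (j + 1)) :
    ∑ t ∈ Finset.range T, (if flag (J t) then eps (J t + 1) else 0) ≤
      (K + 1) * D + 37 * √(T * y) := by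
  by_cases hflag : ∃ t < T, flag (J t)
  · have hD1 : 1 ≤ D := by obtain ⟨t, ht, hf⟩ := hflag; exact hD t ht hf
    have hT0 : (0 : ℝ) < T := by exact_mod_cast hT
    set r := √(T * y) with hr
    have hr0 : 0 ≤ r := Real.sqrt_nonneg _
    have hrsq : r * r = T * y := Real.mul_self_sqrt (by positivity)
    -- Stages with `2^(j+1) > w` cost at most `1/w` per play, in total `r + 1`. For the others the
    -- powers of two sum to at most `2w`, and `y w ≤ r`. The summand `1` ensures `w ≤ T`, as `hq`
    -- requires, allows `y = 0`, and is paid for by `D ≥ 1`.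
    set w : ℝ := T / (r + 1) with hw
    have hw0 : 0 < w := by positivity
    have hwT : w ≤ T := div_le_self hT0.le (by linarith)
    have h1 : ∀ t ∈ Finset.range T, (if flag (J t) then eps (J t + 1) else 0) ≤
        w⁻¹ + if flag (J t) ∧ (2 : ℝ) ^ (J t + 1) ≤ w then eps (J t + 1) else 0 := by
      intro t _
      have hwi : 0 < w⁻¹ := by positivity
      have he := eps_pos (J t + 1)
      by_cases hf : flag (J t)
      · by_cases hc : (2 : ℝ) ^ (J t + 1) ≤ w
        · rw [if_pos hf, if_pos ⟨hf, hc⟩]; linarith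
        · rw [if_pos hf, if_neg (fun h => hc h.2), add_zero, eps_eq_inv]
          exact inv_anti₀ hw0 (not_le.1 hc).le
      · rw [if_neg hf, if_neg (fun h => hf h.1), add_zero]
        exact hwi.le
    have h2 : ∑ t ∈ Finset.range T,
        (if flag (J t) ∧ (2 : ℝ) ^ (J t + 1) ≤ w then eps (J t + 1) else 0) ≤
        ∑ j ∈ Finset.range T, (K * D * eps (j + 1) +
          18 * y * if (2 : ℝ) ^ (j + 1) ≤ w then (2 : ℝ) ^ (j + 1) else 0) := by
      rw [← Finset.sum_fiberwise_of_maps_to (g := J) (t := Finset.range T)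
        (fun t ht => Finset.mem_range.2 (hJ t (Finset.mem_range.1 ht)))]
      refine Finset.sum_le_sum fun j _ => ?_
      have he := eps_pos (j + 1)
      have hnn : 0 ≤ K * D * eps (j + 1) := by positivity
      have hnn' : 0 ≤ 18 * y * if (2 : ℝ) ^ (j + 1) ≤ w then (2 : ℝ) ^ (j + 1) else 0 := by
        split_ifs <;> positivity
      by_cases hc : (∃ t < T, J t = j) ∧ flag j ∧ (2 : ℝ) ^ (j + 1) ≤ w
      · obtain ⟨⟨t₀, ht₀, rfl⟩, hf, hle⟩ := hc
        have h3 : ∑ t ∈ (Finset.range T).filter (fun t => J t = J t₀),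
            (if flag (J t) ∧ (2 : ℝ) ^ (J t + 1) ≤ w then eps (J t + 1) else 0) =
            ((Finset.range T).filter fun t => J t = J t₀).card * eps (J t₀ + 1) := by
          rw [← nsmul_eq_mul, ← Finset.sum_const]
          refine Finset.sum_congr rfl fun t ht => ?_
          rw [(Finset.mem_filter.1 ht).2, if_pos ⟨hf, hle⟩]
        rw [h3, if_pos hle]
        have h4 := mul_le_mul_of_nonneg_right (hn t₀ ht₀ hf) he.le
        have h5 := hq (J t₀) (hle.trans hwT)
        linarith
      · rw [Finset.sum_eq_zero]
        · linarith
        · intro t ht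
          obtain ⟨htT, rfl⟩ := Finset.mem_filter.1 ht
          exact if_neg fun h => hc ⟨⟨t, Finset.mem_range.1 htT, rfl⟩, h⟩
    have h3 : y * w ≤ r := by
      rw [hw, mul_div_assoc', div_le_iff₀ (by positivity)]
      nlinarith
    have h4 := sum_two_pow_le hw0.le T
    have h5 := sum_eps_succ_le_one T
    calc _ ≤ ∑ t ∈ Finset.range T, (w⁻¹ +
          if flag (J t) ∧ (2 : ℝ) ^ (J t + 1) ≤ w then eps (J t + 1) else 0) :=
          Finset.sum_le_sum h1
      _ ≤ T * w⁻¹ + (K * D * ∑ j ∈ Finset.range T, eps (j + 1) + 18 * y *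
          ∑ j ∈ Finset.range T, if (2 : ℝ) ^ (j + 1) ≤ w then (2 : ℝ) ^ (j + 1) else 0) := by
          rw [Finset.sum_add_distrib, Finset.sum_const, Finset.card_range, nsmul_eq_mul,
            Finset.mul_sum, Finset.mul_sum, ← Finset.sum_add_distrib]
          linarith
      _ ≤ (r + 1) + (K * D * 1 + 18 * y * (2 * w)) := by
          have : T * w⁻¹ = r + 1 := by rw [hw, inv_div]; field_simp
          rw [this]
          gcongr
      _ ≤ _ := by nlinarith
  · push Not at hflag
    rw [Finset.sum_eq_zero fun t ht => if_neg (hflag t (Finset.mem_range.1 ht))]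
    positivity

theorem log_stage_le {ℓ T N : ℕ} (hℓ : 1 ≤ ℓ) (hT : (2 : ℝ) ^ ℓ ≤ T) (hN : 2 ≤ N) {δ : ℝ}
    (hδ0 : 0 < δ) (hδ1 : δ < 1) :
    Real.log (4 * (ℓ : ℝ) ^ 2 * N / δ) ≤ 9 * Real.log (N * Real.log T / δ) := by
  have hl2 := Real.log_two_gt_d9
  have hN' : (2 : ℝ) ≤ N := by exact_mod_cast hN
  have hℓ' : (1 : ℝ) ≤ ℓ := by exact_mod_cast hℓ
  set s := Real.log T with hs
  have hs1 : ℓ * Real.log 2 ≤ s := by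
    rw [hs, ← Real.log_pow]
    exact Real.log_le_log (by positivity) hT
  have hs2 : (0.69 : ℝ) * ℓ ≤ s := by nlinarith
  set b := (N : ℝ) / δ with hb
  have hb2 : 2 ≤ b := by rw [hb, le_div_iff₀ hδ0]; nlinarith
  have hs0 : 0.69 ≤ s := by nlinarith
  have ha : 1.38 ≤ b * s := by nlinarith
  have e1 : N * s / δ = b * s := by rw [hb]; ring
  have e2 : 4 * (ℓ : ℝ) ^ 2 * N / δ = 4 * (ℓ : ℝ) ^ 2 * b := by rw [hb]; ring
  -- With `b = N / δ` and `s = log T`, the exponent 9 leaves seven spare factors `b s ≥ 1.38`, and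
  -- `1.38^7` exceeds `4 / 0.69²`.
  rw [e1, e2, show (9 : ℝ) * Real.log (b * s) = Real.log ((b * s) ^ 9) by
    rw [Real.log_pow]; norm_num]
  refine Real.log_le_log (by positivity) ?_
  have h1 : (0.69 : ℝ) ^ 2 * ℓ ^ 2 ≤ s ^ 2 := by
    rw [← mul_pow]; exact pow_le_pow_left₀ (by positivity) hs2 2
  have h7 : (1.38 : ℝ) ^ 7 ≤ (b * s) ^ 7 := pow_le_pow_left₀ (by norm_num) ha 7
  have h8 : (b * s) ^ 9 = (b * s) ^ 2 * (b * s) ^ 7 := by ring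
  have hbb : b ≤ b ^ 2 := by nlinarith
  have h9 : 4 * (ℓ : ℝ) ^ 2 * b ≤ 4 * (s ^ 2 / 0.69 ^ 2) * b ^ 2 := by
    gcongr
    rw [le_div_iff₀ (by norm_num)]; linarith
  have h10 : (b * s) ^ 2 * (1.38 : ℝ) ^ 7 ≤ (b * s) ^ 2 * (b * s) ^ 7 := by gcongr
  rw [h8]
  refine h9.trans (le_trans ?_ h10)
  have : 0 ≤ b ^ 2 * s ^ 2 := by positivity
  rw [mul_pow]
  norm_num
  linarith

end Summation

section Regret

variable {α : Type*} [Fintype α] {H : Type*} [NormedAddCommGroup H] [InnerProductSpace ℝ H]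

theorem one_le_stage_log_arg [Nonempty α] {δ : ℝ} (hδ0 : 0 < δ) (hδ1 : δ < 1) (j : ℕ) :
    4 ≤ 4 * ((j + 1 : ℕ) : ℝ) ^ 2 * Fintype.card α / δ := by
  have h1 : (1 : ℝ) ≤ ((j + 1 : ℕ) : ℝ) := by push_cast; linarith [Nat.cast_nonneg (α := ℝ) j]
  have h2 : (1 : ℝ) ≤ Fintype.card α := by exact_mod_cast Fintype.card_pos
  rw [le_div_iff₀ hδ0]
  nlinarith [mul_le_mul (one_le_pow₀ h1 (n := 2)) h2 (by norm_num) (by positivity)]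

theorem regret_eq_zero_of_subsingleton [Nonempty α] (h : Fintype.card α ≤ 1) (R : Rule α)
    (φ : α → H) (γ σ δ κ : ℝ) (μ : α → ℝ) (ξ : ℕ → ℝ) (T : ℕ) :
    regret R φ γ σ δ κ μ ξ T = 0 := by
  have := Fintype.card_le_one_iff_subsingleton.1 h
  unfold regret
  have h0 : ∀ x : α, ∑ t ∈ Finset.range T, (μ x - μ (action R φ γ σ δ κ μ ξ t)) = 0 := fun x =>
    Finset.sum_eq_zero fun t _ => by rw [Subsingleton.elim (action R φ γ σ δ κ μ ξ t) x, sub_self]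
  simp [h0]

variable [CompleteSpace H]

theorem Rule.len_le [Nonempty α] (R : Rule α) (φ : α → H) {γ : ℝ} (hγ : 0 < γ) (σ : ℝ)
    {δ κ : ℝ} (hδ0 : 0 < δ) (hδ1 : δ < 1) (hκ : 0 ≤ κ) (j : ℕ) {V : Finset α} (hV : V.Nonempty) :
    (R.len φ γ σ δ κ (j + 1) V : ℝ) ≤ κ * effDim φ γ (R.design V) + 2 +
      2 * σ ^ 2 * (eps (j + 1))⁻¹ ^ 2 * maxOptValue φ γ *
        Real.log (4 * ((j + 1 : ℕ) : ℝ) ^ 2 * Fintype.card α / δ) := by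
  set L := Real.log (4 * ((j + 1 : ℕ) : ℝ) ^ 2 * Fintype.card α / δ) with hL
  have hL0 : 0 ≤ L := Real.log_nonneg (by linarith [one_le_stage_log_arg (α := α) hδ0 hδ1 j])
  have hF := optValue_le_maxOptValue φ γ hV
  have hf0 := optValue_nonneg φ hγ V
  have he := eps_pos (j + 1)
  have h1 : 2 * σ ^ 2 * (eps (j + 1))⁻¹ ^ 2 * optValue φ γ V * L ≤
      2 * σ ^ 2 * (eps (j + 1))⁻¹ ^ 2 * maxOptValue φ γ * L := by gcongr
  have h2 : 0 ≤ 2 * σ ^ 2 * (eps (j + 1))⁻¹ ^ 2 * optValue φ γ V * L := by positivity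
  have h3 : 0 ≤ κ * effDim φ γ (R.design V) := by positivity
  set z := max (2 * σ ^ 2 * (eps (j + 1))⁻¹ ^ 2 * optValue φ γ V * L)
    (κ * effDim φ γ (R.design V)) with hz
  have hz1 : z ≤ 2 * σ ^ 2 * (eps (j + 1))⁻¹ ^ 2 * optValue φ γ V * L +
      κ * effDim φ γ (R.design V) := max_le (by linarith) (by linarith)
  have hz0 : 0 ≤ z := h3.trans (le_max_right _ _)
  have hlen : R.len φ γ σ δ κ (j + 1) V = max 1 ⌈z⌉₊ := rfl
  have hceil := Nat.ceil_lt_add_one hz0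
  rw [hlen, Nat.cast_max]
  refine max_le ?_ ?_
  · push_cast; linarith
  · linarith

theorem bias_le (φ : α → H) {γ : ℝ} (hγ : 0 < γ) (θ : H) {h : ℝ} (hh : 0 ≤ h)
    (hcase : h = 0 ∨ ∃ x, γ ≤ ‖φ x‖ ^ 2) :
    bias φ γ θ h ≤ 4 * (√(maxOptValue φ γ) * (√γ * ‖θ‖ + h)) := by
  have h1 : h ≤ 2 * (√(maxOptValue φ γ) * h) := by
    rcases hcase with rfl | ⟨x, hx⟩
    · simp
    · have := half_le_maxOptValue φ hγ hx
      have h2 : 1 / 2 ≤ √(maxOptValue φ γ) := Real.le_sqrt_of_sq_le (by linarith)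
      nlinarith
  have h2 : 0 ≤ √(maxOptValue φ γ) * (√γ * ‖θ‖) := by positivity
  unfold bias
  nlinarith

open Classical in
/-- The regret bound on the event that the noise is small in all stages. -/
theorem regret_le [Nonempty α] {R : Rule α} {φ : α → H} {γ σ δ κ : ℝ} {μ : α → ℝ} {ξ : ℕ → ℝ}
    (hγ : 0 < γ) (hδ0 : 0 < δ) (hδ1 : δ < 1) (hκ : 0 ≤ κ)
    (hR : R.IsPTR φ γ σ δ κ) {θ : H} {h B : ℝ} (hh : 0 ≤ h)
    (hμ : ∀ x, |μ x - ⟪θ, φ x⟫_ℝ| ≤ h) (hB : ∀ x, |μ x| ≤ B)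
    (hcase : h = 0 ∨ ∃ x, γ ≤ ‖φ x‖ ^ 2)
    (hgood : ∀ j, NoiseSmall R φ γ σ δ κ μ ξ j) {T : ℕ} (hT : 2 ≤ T) :
    regret R φ γ σ δ κ μ ξ T ≤ 32 * (κ + 40) * max 1 B *
      ((runEffDim R φ γ σ δ κ μ ξ T : ℝ) + √(maxOptValue φ γ) *
        (T * (√γ * ‖θ‖ + h) +
          √(σ ^ 2 * Real.log (Fintype.card α * Real.log T / δ) * T))) := by
  have hB1 : 1 ≤ max 1 B := le_max_left _ _
  -- With one arm the logarithm may be negative, but the regret vanishes.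
  rcases le_or_gt (Fintype.card α) 1 with hcard | hcard
  · rw [regret_eq_zero_of_subsingleton hcard]
    positivity
  have hF := maxOptValue_nonneg φ hγ
  set F := maxOptValue φ γ with hFdef
  set D := runEffDim R φ γ σ δ κ μ ξ T with hD
  set Λ := Real.log (Fintype.card α * Real.log T / δ) with hΛ
  have hN : (2 : ℝ) ≤ Fintype.card α := by exact_mod_cast hcard
  have hΛ0 : 0 ≤ Λ := by
    apply Real.log_nonneg
    rw [le_div_iff₀ hδ0]
    have h1 : Real.log 2 ≤ Real.log T :=
      Real.log_le_log (by norm_num) (by exact_mod_cast hT)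
    have := Real.log_two_gt_d9
    nlinarith
  set st := stage R φ γ σ δ κ μ ξ with hst
  set J := stageAt R φ γ σ δ κ μ ξ with hJ
  have hdim : ∀ t < T, 1 < (st (J t)).1.card → effDim φ γ (R.design (st (J t)).1) ≤ D := by
    intro t ht hc
    have h1 := Finset.le_sup (f := fun t =>
      let V := (stage R φ γ σ δ κ μ ξ (stageAt R φ γ σ δ κ μ ξ t)).1
      if 1 < V.card then effDim φ γ (R.design V) else 0) (Finset.mem_range.2 ht)
    simp only at h1
    rw [if_pos hc] at h1
    exact h1
  set y := σ ^ 2 * F * Λ with hy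
  have hy0 : 0 ≤ y := by positivity
  set q : ℕ → ℝ := fun j => 2 * σ ^ 2 * (eps (j + 1))⁻¹ ^ 2 * F *
    Real.log (4 * ((j + 1 : ℕ) : ℝ) ^ 2 * Fintype.card α / δ) with hq
  -- `K = κ + 2`: the additive `2` in the stage length is at most `2D`, because the flagged stages
  -- have positive effective dimension. The factor 18 is the 2 of the stage length times the 9 of
  -- `log_stage_le`.
  have hsum := sum_eps_stages_le (T := T) (by omega) (J := J)
    (fun t ht => (stageAt_le R φ γ σ δ κ μ ξ t).trans_lt ht)
    (flag := fun j => 1 < (st j).1.card ∧ effDim φ γ (R.design (st j).1) ≠ 0)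
    (K := κ + 2) (D := (D : ℝ)) (y := y) (by linarith) (Nat.cast_nonneg _) hy0
    (fun t ht hf => by
      have := hdim t ht hf.1
      exact_mod_cast (Nat.one_le_iff_ne_zero.2 hf.2).trans this)
    (q := q) (fun t ht hf => by
      have h1 := card_stageAt_eq_le R φ γ σ δ κ μ ξ hf.1 T
      have h2 := R.len_le φ hγ σ hδ0 hδ1 hκ (J t) (stage_nonempty R φ γ σ δ κ μ ξ (J t))
      have h3 : (effDim φ γ (R.design (st (J t)).1) : ℝ) ≤ D := by exact_mod_cast hdim t ht hf.1
      have h4 : (1 : ℝ) ≤ effDim φ γ (R.design (st (J t)).1) := by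
        exact_mod_cast Nat.one_le_iff_ne_zero.2 hf.2
      have h5 : (((Finset.range T).filter fun t' => J t' = J t).card : ℝ) ≤
          R.len φ γ σ δ κ (J t + 1) (st (J t)).1 := by
        refine le_trans (le_of_eq ?_) (Nat.cast_le.2 h1)
        congr
      have h6 : κ * effDim φ γ (R.design (st (J t)).1) ≤ κ * D := by gcongr
      refine (h5.trans h2).trans ?_
      change κ * effDim φ γ (R.design (st (J t)).1) + 2 + q (J t) ≤ _
      linarith)
    (fun j hj => by
      have h1 := log_stage_le (Nat.succ_le_succ (Nat.zero_le j)) hj hcard hδ0 hδ1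
      have h2 : (eps (j + 1))⁻¹ = 2 ^ (j + 1) := by rw [eps_eq_inv, inv_inv]
      have h3 : q j * eps (j + 1) = 2 * σ ^ 2 * F * 2 ^ (j + 1) *
          Real.log (4 * ((j + 1 : ℕ) : ℝ) ^ 2 * Fintype.card α / δ) := by
        simp only [hq]
        rw [h2, eps_eq_inv]
        field_simp
      rw [h3]
      calc _ ≤ 2 * σ ^ 2 * F * 2 ^ (j + 1) * (9 * Λ) := by gcongr
        _ = _ := by rw [hy]; ring)
  have hsqrt : √(T * y) = √F * √(σ ^ 2 * Λ * T) := by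
    rw [← Real.sqrt_mul hF]
    congr 1
    rw [hy]; ring
  rw [hsqrt] at hsum
  have hsum' : (∑ t ∈ Finset.range T,
      if 1 < (st (J t)).1.card ∧ effDim φ γ (R.design (st (J t)).1) ≠ 0
        then eps (J t + 1) else 0) ≤
      (κ + 2 + 1) * D + 37 * (√F * √(σ ^ 2 * Λ * T)) := by convert hsum
  have hbias := bias_le φ hγ θ hh hcase
  rw [← hFdef] at hbias
  obtain ⟨x₀, hbest⟩ := Finite.exists_max μ
  have hreg : regret R φ γ σ δ κ μ ξ T ≤
      ∑ t ∈ Finset.range T, (μ x₀ - μ (action R φ γ σ δ κ μ ξ t)) := by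
    refine ciSup_le fun x => Finset.sum_le_sum fun t _ => ?_
    have := hbest x
    linarith
  refine hreg.trans ?_
  have hsum2 : ∑ t ∈ Finset.range T, (μ x₀ - μ (action R φ γ σ δ κ μ ξ t)) ≤
      ∑ t ∈ Finset.range T, (16 * max 1 B * bias φ γ θ h + 32 * max 1 B *
        if 1 < (st (J t)).1.card ∧ effDim φ γ (R.design (st (J t)).1) ≠ 0
          then eps (J t + 1) else 0) := by
    refine Finset.sum_le_sum fun t _ => ?_
    have := gap_le hγ hR hh hμ hB hgood hbest (action_mem_stage R φ γ σ δ κ μ ξ hR t)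
    refine this.trans (le_of_eq ?_)
    rw [mul_ite, mul_zero]
  refine hsum2.trans ?_
  rw [Finset.sum_add_distrib, Finset.sum_const, Finset.card_range, nsmul_eq_mul, ← Finset.mul_sum]
  have hB0 : 0 ≤ max 1 B := by linarith
  set P := √F * (√γ * ‖θ‖ + h) with hP
  set Q := √F * √(σ ^ 2 * Λ * T) with hQ
  have hP0 : 0 ≤ P := by positivity
  have hQ0 : 0 ≤ Q := by positivity
  have hTD : (0 : ℝ) ≤ D := Nat.cast_nonneg _
  have e : √F * (T * (√γ * ‖θ‖ + h) + √(σ ^ 2 * Λ * T)) = T * P + Q := by rw [hP, hQ]; ring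
  rw [e]
  calc _ ≤ T * (16 * max 1 B * (4 * P)) +
        32 * max 1 B * ((κ + 2 + 1) * D + 37 * Q) :=
          add_le_add (mul_le_mul_of_nonneg_left (mul_le_mul_of_nonneg_left hbias (by positivity))
            (Nat.cast_nonneg _)) (mul_le_mul_of_nonneg_left hsum' (by positivity))
    _ = 32 * max 1 B * (2 * (T * P) + (κ + 3) * D + 37 * Q) := by ring
    _ ≤ 32 * max 1 B * ((κ + 40) * (T * P) + (κ + 40) * D + (κ + 40) * Q) := by
        gcongr <;> linarith
    _ = _ := by ring

end Regret

end PTRBandit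

end

/-! ### Sub-Gaussian tails, measurability and the good event. -/

noncomputable section

namespace PTRBandit

section Tail

open MeasureTheory ProbabilityTheory

variable {Ω : Type*} [MeasurableSpace Ω] {P : Measure Ω}

theorem hasSubgaussianMGF_mono {X : Ω → ℝ} {c c' : NNReal} (h : HasSubgaussianMGF X c P)
    (hc : c ≤ c') : HasSubgaussianMGF X c' P where
  integrable_exp_mul := h.integrable_exp_mul
  mgf_le t := (h.mgf_le t).trans (Real.exp_le_exp.2 (by
    have : (c : ℝ) ≤ c' := by exact_mod_cast hc
    gcongr))

/-- A two-sided tail bound for a weighted sum of independent sub-Gaussian variables. -/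
theorem measure_abs_weighted_sum_gt_le {ξ : ℕ → Ω → ℝ} (hind : iIndepFun ξ P) {σ : ℝ}
    (hsub : ∀ t, HasSubgaussianMGF (ξ t) (Real.toNNReal (σ ^ 2)) P) (w : ℕ → ℝ) (τ s : ℕ)
    {v e : ℝ} (hv0 : 0 ≤ v) (he : 0 ≤ e) (hv : σ ^ 2 * ∑ i ∈ Finset.range τ, w i ^ 2 ≤ v) :
    P {ω | e < |∑ i ∈ Finset.range τ, ξ (s + i) ω * w i|} ≤
      ENNReal.ofReal (2 * Real.exp (-e ^ 2 / (2 * v))) := by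
  have : IsProbabilityMeasure P := hind.isProbabilityMeasure
  have hind' : iIndepFun (fun i ω => w i * ξ (s + i) ω) P :=
    (hind.precomp (g := fun i => s + i) (add_right_injective s)).comp (fun i x => w i * x)
      fun i => measurable_const_mul (w i)
  have hS : HasSubgaussianMGF (fun ω => ∑ i ∈ Finset.range τ, w i * ξ (s + i) ω) v.toNNReal P := by
    refine hasSubgaussianMGF_mono (HasSubgaussianMGF.sum_of_iIndepFun hind'
      fun i _ => (hsub (s + i)).const_mul (w i)) ?_
    rw [← NNReal.coe_le_coe, Real.coe_toNNReal _ hv0]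
    push_cast
    refine le_trans (le_of_eq ?_) hv
    rw [Finset.mul_sum]
    refine Finset.sum_congr rfl fun i _ => ?_
    change w i ^ 2 * ((σ ^ 2).toNNReal : ℝ) = σ ^ 2 * w i ^ 2
    rw [Real.coe_toNNReal _ (sq_nonneg σ), mul_comm]
  have h1 := hS.measure_ge_le he
  have h2 := hS.neg.measure_ge_le he
  rw [Real.coe_toNNReal _ hv0] at h1 h2
  have hsubset : {ω | e < |∑ i ∈ Finset.range τ, ξ (s + i) ω * w i|} ⊆
      {ω | e ≤ ∑ i ∈ Finset.range τ, w i * ξ (s + i) ω} ∪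
        {ω | e ≤ (-fun ω => ∑ i ∈ Finset.range τ, w i * ξ (s + i) ω) ω} := by
    intro ω hω
    simp only [Set.mem_ofPred_eq, mul_comm (ξ _ _)] at hω
    rcases lt_abs.1 hω with h | h
    · exact Or.inl h.le
    · exact Or.inr h.le
  refine (measure_mono hsubset).trans ((measure_union_le _ _).trans ?_)
  rw [two_mul, ENNReal.ofReal_add (Real.exp_pos _).le (Real.exp_pos _).le]
  exact add_le_add
    ((ENNReal.le_ofReal_iff_toReal_le (measure_ne_top _ _) (Real.exp_pos _).le).2 h1)
    ((ENNReal.le_ofReal_iff_toReal_le (measure_ne_top _ _) (Real.exp_pos _).le).2 h2)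

end Tail

section Measurability

open MeasureTheory

variable {α : Type*} [Fintype α] {H : Type*} [NormedAddCommGroup H] [InnerProductSpace ℝ H]
variable (R : Rule α) (φ : α → H) (γ σ δ κ : ℝ) (μ : α → ℝ)

/-- The active set and the starting time of a stage depend only on the noise of earlier times. -/
theorem stage_congr {ξ ξ' : ℕ → ℝ} {j : ℕ}
    (h : ∀ i < (stage R φ γ σ δ κ μ ξ j).2, ξ i = ξ' i) :
    stage R φ γ σ δ κ μ ξ' j = stage R φ γ σ δ κ μ ξ j := by
  induction j with
  | zero => rfl
  | succ j ih =>
    have hlt := stage_start_lt_succ R φ γ σ δ κ μ ξ j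
    have ih' := ih fun i hi => h i (hi.trans hlt)
    by_cases hc : 1 < (stage R φ γ σ δ κ μ ξ j).1.card
    · have hc' : 1 < (stage R φ γ σ δ κ μ ξ' j).1.card := by rwa [ih']
      rw [stage_succ_of_one_lt R φ γ σ δ κ μ ξ hc] at h
      rw [stage_succ_of_one_lt R φ γ σ δ κ μ ξ hc, stage_succ_of_one_lt R φ γ σ δ κ μ ξ' hc', ih']
      congr 2
      unfold estimate
      congr 1
      refine Finset.sum_congr rfl fun i hi => ?_
      rw [h _ (Nat.add_lt_add_left (Finset.mem_range.1 hi) _)]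
    · have hc' : ¬ 1 < (stage R φ γ σ δ κ μ ξ' j).1.card := by rwa [ih']
      rw [stage_succ_of_not_one_lt R φ γ σ δ κ μ ξ hc,
        stage_succ_of_not_one_lt R φ γ σ δ κ μ ξ' hc', ih']

theorem measurable_inner_estimate {α : Type*} (φ : α → H) (γ : ℝ) (μ : α → ℝ) (a : ℕ → α)
    (τ s : ℕ) (x : α) : Measurable fun ξ : ℕ → ℝ => ⟪φ x, estimate φ γ μ ξ a τ s⟫_ℝ := by
  simp only [inner_estimate]
  fun_prop

theorem measurableSet_survivors_eq (ℓ : ℕ) (V : Finset α) (a : ℕ → α) (τ s : ℕ) (V' : Finset α) :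
    MeasurableSet {ξ : ℕ → ℝ | survivors φ ℓ V (estimate φ γ μ ξ a τ s) = V'} := by
  have h : {ξ : ℕ → ℝ | survivors φ ℓ V (estimate φ γ μ ξ a τ s) = V'} =
      ⋂ x, {ξ : ℕ → ℝ | x ∈ survivors φ ℓ V (estimate φ γ μ ξ a τ s) ↔ x ∈ V'} := by
    ext ξ
    simp only [Set.mem_ofPred_eq, Set.mem_iInter, Finset.ext_iff]
  rw [h]
  refine MeasurableSet.iInter fun x => ?_
  have hx : MeasurableSet {ξ : ℕ → ℝ | x ∈ survivors φ ℓ V (estimate φ γ μ ξ a τ s)} := by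
    have hxe : {ξ : ℕ → ℝ | x ∈ survivors φ ℓ V (estimate φ γ μ ξ a τ s)} = {_ξ | x ∈ V} ∩
        ⋂ x' ∈ V, {ξ : ℕ → ℝ | ⟪φ x', estimate φ γ μ ξ a τ s⟫_ℝ -
          ⟪φ x, estimate φ γ μ ξ a τ s⟫_ℝ < 8 * eps ℓ} := by
      ext ξ
      simp [mem_survivors]
    rw [hxe]
    refine (MeasurableSet.const _).inter ?_
    refine MeasurableSet.iInter fun x' => MeasurableSet.iInter fun _ => ?_
    exact measurableSet_lt ((measurable_inner_estimate φ γ μ a τ s x').sub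
      (measurable_inner_estimate φ γ μ a τ s x)) measurable_const
  by_cases hV : x ∈ V'
  · simpa only [hV, iff_true] using hx
  · simp only [hV, iff_false]
    exact hx.compl

/-- The preceding stage takes countably many values, and for each of them survival is decided by
finitely many measurable inequalities. -/
theorem measurableSet_stage_eq (j : ℕ) (p : Finset α × ℕ) :
    MeasurableSet {ξ : ℕ → ℝ | stage R φ γ σ δ κ μ ξ j = p} := by
  induction j generalizing p with
  | zero => exact MeasurableSet.const ((Finset.univ, 0) = p)
  | succ j ih =>
    have h : {ξ : ℕ → ℝ | stage R φ γ σ δ κ μ ξ (j + 1) = p} =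
        ⋃ q : Finset α × ℕ, {ξ : ℕ → ℝ | stage R φ γ σ δ κ μ ξ j = q} ∩
          {ξ : ℕ → ℝ | if 1 < q.1.card then
            survivors φ (j + 1) q.1 (estimate φ γ μ ξ (R.alloc (j + 1) q.1)
              (R.len φ γ σ δ κ (j + 1) q.1) q.2) = p.1 ∧
                q.2 + R.len φ γ σ δ κ (j + 1) q.1 = p.2
            else (q.1, q.2 + 1) = p} := by
      ext ξ
      simp only [Set.mem_iUnion, Set.mem_inter_iff, Set.mem_ofPred_eq, exists_eq_left']
      by_cases hc : 1 < (stage R φ γ σ δ κ μ ξ j).1.card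
      · rw [stage_succ_of_one_lt R φ γ σ δ κ μ ξ hc, if_pos hc, Prod.ext_iff]
      · rw [stage_succ_of_not_one_lt R φ γ σ δ κ μ ξ hc, if_neg hc]
    rw [h]
    refine MeasurableSet.iUnion fun q => (ih q).inter ?_
    split_ifs with hc
    · exact (measurableSet_survivors_eq φ γ μ _ _ _ _ _ _).inter (MeasurableSet.const _)
    · exact MeasurableSet.const _

/-- The noise sequences that spoil some prediction in stage `j + 1`, if that stage starts at time
`p.2` with the active set `p.1`. -/
def noiseBad (j : ℕ) (p : Finset α × ℕ) : Set (ℕ → ℝ) :=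
  {ξ | 1 < p.1.card ∧ ∃ x ∈ p.1, 2 * eps (j + 1) <
    |∑ i ∈ Finset.range (R.len φ γ σ δ κ (j + 1) p.1), ξ (p.2 + i) *
      predWeight φ γ (R.alloc (j + 1) p.1) (R.len φ γ σ δ κ (j + 1) p.1) x i|}

theorem not_noiseSmall_iff {ξ : ℕ → ℝ} {j : ℕ} : ¬ NoiseSmall R φ γ σ δ κ μ ξ j ↔
    ξ ∈ noiseBad R φ γ σ δ κ j (stage R φ γ σ δ κ μ ξ j) := by
  simp only [NoiseSmall, noiseBad, Set.mem_ofPred_eq]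
  push Not
  rfl

theorem measurableSet_noiseBad (j : ℕ) (p : Finset α × ℕ) :
    MeasurableSet (noiseBad R φ γ σ δ κ j p) := by
  have h : noiseBad R φ γ σ δ κ j p = {_ξ | 1 < p.1.card} ∩ ⋃ x ∈ p.1,
      {ξ : ℕ → ℝ | 2 * eps (j + 1) <
        |∑ i ∈ Finset.range (R.len φ γ σ δ κ (j + 1) p.1), ξ (p.2 + i) *
          predWeight φ γ (R.alloc (j + 1) p.1) (R.len φ γ σ δ κ (j + 1) p.1) x i|} := by
    ext ξ
    simp [noiseBad]
  rw [h]
  refine (MeasurableSet.const _).inter (Finset.measurableSet_biUnion _ fun x _ => ?_)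
  refine measurableSet_lt measurable_const ?_
  simp only [← Real.norm_eq_abs]
  fun_prop

theorem mem_noiseBad_congr {j : ℕ} {p : Finset α × ℕ} {ξ ξ' : ℕ → ℝ}
    (h : ∀ i, p.2 ≤ i → i < p.2 + R.len φ γ σ δ κ (j + 1) p.1 → ξ i = ξ' i) :
    ξ ∈ noiseBad R φ γ σ δ κ j p ↔ ξ' ∈ noiseBad R φ γ σ δ κ j p := by
  have : ∀ x, ∑ i ∈ Finset.range (R.len φ γ σ δ κ (j + 1) p.1), ξ (p.2 + i) *
      predWeight φ γ (R.alloc (j + 1) p.1) (R.len φ γ σ δ κ (j + 1) p.1) x i =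
      ∑ i ∈ Finset.range (R.len φ γ σ δ κ (j + 1) p.1), ξ' (p.2 + i) *
      predWeight φ γ (R.alloc (j + 1) p.1) (R.len φ γ σ δ κ (j + 1) p.1) x i := fun x =>
    Finset.sum_congr rfl fun i hi => by
      rw [h _ (Nat.le_add_right _ _) (Nat.add_lt_add_left (Finset.mem_range.1 hi) _)]
  simp only [noiseBad, Set.mem_ofPred_eq, this]

/-- The extension by zero of finitely many values to a sequence. -/
def extendZero (S : Finset ℕ) (y : S → ℝ) (i : ℕ) : ℝ :=
  if h : i ∈ S then y ⟨i, h⟩ else 0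

theorem extendZero_apply {S : Finset ℕ} (y : ℕ → ℝ) {i : ℕ} (hi : i ∈ S) :
    extendZero S (fun i : S => y i) i = y i := dif_pos hi

theorem measurable_extendZero (S : Finset ℕ) : Measurable (extendZero S) := by
  refine measurable_pi_lambda _ fun i => ?_
  unfold extendZero
  split_ifs with h
  · exact measurable_pi_apply _
  · exact measurable_const

end Measurability

section GoodEvent

open MeasureTheory ProbabilityTheory

variable {α : Type*} [Fintype α] {H : Type*} [NormedAddCommGroup H] [InnerProductSpace ℝ H]
variable {R : Rule α} {φ : α → H} {γ σ δ κ : ℝ} (μ : α → ℝ)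
variable {Ω : Type*} [MeasurableSpace Ω] {P : Measure Ω} {ξ : ℕ → Ω → ℝ}

/-- For fixed `p` the first event depends on the noise before `p.2` only, the second on the noise of
the following `len` times only. Extending these finite blocks by zero exhibits both as functions of
disjoint families. -/
theorem measure_stage_inter_noiseBad (hind : iIndepFun ξ P) (hmeas : ∀ t, Measurable (ξ t))
    (j : ℕ) (p : Finset α × ℕ) :
    P ({ω | stage R φ γ σ δ κ μ (fun t => ξ t ω) j = p} ∩
        {ω | (fun t => ξ t ω) ∈ noiseBad R φ γ σ δ κ j p}) =
      P {ω | stage R φ γ σ δ κ μ (fun t => ξ t ω) j = p} *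
        P {ω | (fun t => ξ t ω) ∈ noiseBad R φ γ σ δ κ j p} := by
  set S := Finset.range p.2
  set T := Finset.Ico p.2 (p.2 + R.len φ γ σ δ κ (j + 1) p.1)
  have hdisj : Disjoint S T := by
    rw [Finset.disjoint_left]
    intro i hi hi'
    have h1 := Finset.mem_range.1 hi
    have h2 := (Finset.mem_Ico.1 hi').1
    omega
  have hI := hind.indepFun_finset S T hdisj hmeas
  have h1 : {ω | stage R φ γ σ δ κ μ (fun t => ξ t ω) j = p} =
      (fun ω (i : S) => ξ i ω) ⁻¹'
        (extendZero S ⁻¹' {ζ | stage R φ γ σ δ κ μ ζ j = p}) := by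
    ext ω
    simp only [Set.mem_ofPred_eq, Set.mem_preimage]
    have hagree : ∀ i < p.2, ξ i ω = extendZero S (fun i : S => ξ i ω) i := fun i hi =>
      (extendZero_apply (fun i => ξ i ω) (Finset.mem_range.2 hi)).symm
    constructor
    · intro h
      rw [← h]
      exact stage_congr R φ γ σ δ κ μ fun i hi => hagree i (h ▸ hi)
    · intro h
      rw [← h]
      exact stage_congr R φ γ σ δ κ μ fun i hi => (hagree i (h ▸ hi)).symm
  have h2 : {ω | (fun t => ξ t ω) ∈ noiseBad R φ γ σ δ κ j p} =
      (fun ω (i : T) => ξ i ω) ⁻¹' (extendZero T ⁻¹' noiseBad R φ γ σ δ κ j p) := by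
    ext ω
    simp only [Set.mem_ofPred_eq, Set.mem_preimage]
    exact mem_noiseBad_congr R φ γ σ δ κ fun i hi hi' =>
      (extendZero_apply (fun i => ξ i ω) (Finset.mem_Ico.2 ⟨hi, hi'⟩)).symm
  rw [h1, h2]
  exact hI.measure_inter_preimage_eq_mul _ _
    (measurable_extendZero S (measurableSet_stage_eq R φ γ σ δ κ μ j p))
    (measurable_extendZero T (measurableSet_noiseBad R φ γ σ δ κ j p))

variable [CompleteSpace H]

theorem measure_noiseBad_le [Nonempty α] (hγ : 0 < γ) (hδ0 : 0 < δ) (hδ1 : δ < 1)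
    (hR : R.IsPTR φ γ σ δ κ) (hind : iIndepFun ξ P)
    (hsub : ∀ t, HasSubgaussianMGF (ξ t) (Real.toNNReal (σ ^ 2)) P) (j : ℕ) (p : Finset α × ℕ) :
    P {ω | (fun t => ξ t ω) ∈ noiseBad R φ γ σ δ κ j p} ≤
      ENNReal.ofReal (δ / (2 * ((j + 1 : ℕ) : ℝ) ^ 2)) := by
  obtain ⟨V, s⟩ := p
  by_cases hc : 1 < V.card
  swap
  · have : {ω | (fun t => ξ t ω) ∈ noiseBad R φ γ σ δ κ j (V, s)} = ∅ := by
      ext ω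
      simp [noiseBad, hc]
    rw [this, measure_empty]
    exact zero_le
  set a := R.alloc (j + 1) V with ha
  set τ := R.len φ γ σ δ κ (j + 1) V with hτ
  set z := 4 * ((j + 1 : ℕ) : ℝ) ^ 2 * Fintype.card α / δ with hz
  have hz4 : 4 ≤ z := one_le_stage_log_arg hδ0 hδ1 j
  set L := Real.log z with hL
  have hL0 : 0 < L := Real.log_pos (by linarith)
  have he := eps_pos (j + 1)
  have hτ1 : 1 ≤ τ := R.one_le_len φ γ σ δ κ (j + 1) V
  have hτ0 : (0 : ℝ) < τ := by exact_mod_cast hτ1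
  have hlen : 2 * σ ^ 2 * (eps (j + 1))⁻¹ ^ 2 * optValue φ γ V * L ≤ τ := by
    have h1 := (le_max_left _ (κ * effDim φ γ (R.design V))).trans
      (Nat.le_ceil (max (2 * σ ^ 2 * (eps (j + 1))⁻¹ ^ 2 * optValue φ γ V * L)
        (κ * effDim φ γ (R.design V))))
    refine h1.trans ?_
    exact_mod_cast le_max_right 1 _
  have htail : ∀ x ∈ V, P {ω | 2 * eps (j + 1) <
      |∑ i ∈ Finset.range τ, ξ (s + i) ω * predWeight φ γ a τ x i|} ≤
        ENNReal.ofReal (2 * z⁻¹) := by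
    intro x hx
    have hf := optValue_nonneg φ hγ V
    -- The variance bound `4f / τ` meets the choice of `τ`. The proxy `2ε²/L` stays positive even if
    -- `σ` or `f` vanishes.
    have hv : σ ^ 2 * ∑ i ∈ Finset.range τ, predWeight φ γ a τ x i ^ 2 ≤
        2 * eps (j + 1) ^ 2 / L := by
      have h1 := (sum_predWeight_sq_le φ hγ a hτ1 x).trans
        (invNormSq_sampleOp_le hγ (hR.design_mem V hc) (hR.design_min V hc) hτ1
          (hR.alloc_ptr (j + 1) (by omega) V hc) hx)
      refine (mul_le_mul_of_nonneg_left h1 (sq_nonneg σ)).trans ?_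
      rw [mul_div_assoc', div_le_div_iff₀ hτ0 hL0]
      calc σ ^ 2 * (4 * optValue φ γ V) * L
          = 2 * eps (j + 1) ^ 2 * (2 * σ ^ 2 * (eps (j + 1))⁻¹ ^ 2 * optValue φ γ V * L) := by
            field_simp; ring
        _ ≤ 2 * eps (j + 1) ^ 2 * τ := by gcongr
    refine (measure_abs_weighted_sum_gt_le hind hsub _ τ s (by positivity) (by positivity)
      hv).trans (le_of_eq ?_)
    congr 2
    have : -(2 * eps (j + 1)) ^ 2 / (2 * (2 * eps (j + 1) ^ 2 / L)) = -L := by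
      field_simp
    rw [this, Real.exp_neg, hL, Real.exp_log (by linarith)]
  have hset : {ω | (fun t => ξ t ω) ∈ noiseBad R φ γ σ δ κ j (V, s)} ⊆
      ⋃ x ∈ V, {ω | 2 * eps (j + 1) <
        |∑ i ∈ Finset.range τ, ξ (s + i) ω * predWeight φ γ a τ x i|} := by
    rintro ω ⟨-, x, hx, h⟩
    exact Set.mem_biUnion hx h
  refine (measure_mono hset).trans ((measure_biUnion_finset_le _ _).trans ?_)
  refine (Finset.sum_le_sum htail).trans ?_
  rw [Finset.sum_const, nsmul_eq_mul, ← ENNReal.ofReal_natCast, ← ENNReal.ofReal_mul (by positivity)]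
  apply ENNReal.ofReal_le_ofReal
  have hcard : (V.card : ℝ) ≤ Fintype.card α := by exact_mod_cast V.card_le_univ
  have hn : (0 : ℝ) < Fintype.card α := by exact_mod_cast Fintype.card_pos
  -- Each arm fails with probability at most `2 e^(-L) = 2 / z`; the number of arms cancels against
  -- that in `z`.
  calc (V.card : ℝ) * (2 * z⁻¹) ≤ Fintype.card α * (2 * z⁻¹) := by gcongr
    _ = δ / (2 * ((j + 1 : ℕ) : ℝ) ^ 2) := by
      rw [hz]
      have : ((j + 1 : ℕ) : ℝ) ≠ 0 := by positivity
      field_simp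
      norm_num

theorem measure_not_noiseSmall_le [Nonempty α] (hγ : 0 < γ) (hδ0 : 0 < δ) (hδ1 : δ < 1)
    (hR : R.IsPTR φ γ σ δ κ) (hind : iIndepFun ξ P) (hmeas : ∀ t, Measurable (ξ t))
    (hsub : ∀ t, HasSubgaussianMGF (ξ t) (Real.toNNReal (σ ^ 2)) P) (j : ℕ) :
    P {ω | ¬ NoiseSmall R φ γ σ δ κ μ (fun t => ξ t ω) j} ≤
      ENNReal.ofReal (δ / (2 * ((j + 1 : ℕ) : ℝ) ^ 2)) := by
  have : IsProbabilityMeasure P := hind.isProbabilityMeasure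
  have hmeasξ : Measurable fun ω t => ξ t ω := measurable_pi_lambda _ hmeas
  have hset : {ω | ¬ NoiseSmall R φ γ σ δ κ μ (fun t => ξ t ω) j} ⊆
      ⋃ p : Finset α × ℕ, {ω | stage R φ γ σ δ κ μ (fun t => ξ t ω) j = p} ∩
        {ω | (fun t => ξ t ω) ∈ noiseBad R φ γ σ δ κ j p} := by
    intro ω hω
    exact Set.mem_iUnion.2 ⟨_, rfl, (not_noiseSmall_iff R φ γ σ δ κ μ).1 hω⟩
  have hdisj : Pairwise (Function.onFun Disjoint fun p : Finset α × ℕ =>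
      {ω | stage R φ γ σ δ κ μ (fun t => ξ t ω) j = p}) := by
    intro p q hpq
    rw [Function.onFun, Set.disjoint_left]
    intro ω h1 h2
    exact hpq (h1.symm.trans h2)
  calc P {ω | ¬ NoiseSmall R φ γ σ δ κ μ (fun t => ξ t ω) j}
      ≤ ∑' p : Finset α × ℕ, P ({ω | stage R φ γ σ δ κ μ (fun t => ξ t ω) j = p} ∩
        {ω | (fun t => ξ t ω) ∈ noiseBad R φ γ σ δ κ j p}) :=
        (measure_mono hset).trans (measure_iUnion_le _)
    _ ≤ ∑' p : Finset α × ℕ, P {ω | stage R φ γ σ δ κ μ (fun t => ξ t ω) j = p} *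
        ENNReal.ofReal (δ / (2 * ((j + 1 : ℕ) : ℝ) ^ 2)) := by
        refine ENNReal.tsum_le_tsum fun p => ?_
        rw [measure_stage_inter_noiseBad μ hind hmeas]
        gcongr
        exact measure_noiseBad_le hγ hδ0 hδ1 hR hind hsub j p
    _ = P (⋃ p : Finset α × ℕ, {ω | stage R φ γ σ δ κ μ (fun t => ξ t ω) j = p}) *
        ENNReal.ofReal (δ / (2 * ((j + 1 : ℕ) : ℝ) ^ 2)) := by
        rw [ENNReal.tsum_mul_right, measure_iUnion hdisj
          fun p => hmeasξ (measurableSet_stage_eq R φ γ σ δ κ μ j p)]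
    _ ≤ 1 * ENNReal.ofReal (δ / (2 * ((j + 1 : ℕ) : ℝ) ^ 2)) := by
        gcongr
        exact prob_le_one
    _ = _ := one_mul _

/-- Telescopes: with `m = n + 1`, `1 / (2m²) ≤ 1 / (2m - 1) - 1 / (2m + 1)`. -/
theorem tsum_delta_le {δ : ℝ} (hδ0 : 0 < δ) :
    ∑' j : ℕ, ENNReal.ofReal (δ / (2 * ((j + 1 : ℕ) : ℝ) ^ 2)) ≤ ENNReal.ofReal δ := by
  refine ENNReal.tsum_le_of_sum_range_le fun n => ?_
  rw [← ENNReal.ofReal_sum_of_nonneg fun j _ => by positivity]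
  apply ENNReal.ofReal_le_ofReal
  have h : ∑ j ∈ Finset.range n, δ / (2 * ((j + 1 : ℕ) : ℝ) ^ 2) ≤ δ - δ / (2 * n + 1 : ℝ) := by
    induction n with
    | zero => simp
    | succ n ih =>
      rw [Finset.sum_range_succ]
      have hstep : δ / (2 * ((n + 1 : ℕ) : ℝ) ^ 2) ≤
          δ / (2 * n + 1 : ℝ) - δ / (2 * ((n + 1 : ℕ) : ℝ) + 1) := by
        push_cast
        rw [div_sub_div _ _ (by positivity) (by positivity),
          div_le_div_iff₀ (by positivity) (by positivity)]
        nlinarith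
      linarith
  have : 0 < δ / (2 * n + 1 : ℝ) := by positivity
  linarith

theorem ofReal_le_measure_noiseSmall [Nonempty α] (hγ : 0 < γ) (hδ0 : 0 < δ) (hδ1 : δ < 1)
    (hR : R.IsPTR φ γ σ δ κ) (hind : iIndepFun ξ P)
    (hsub : ∀ t, HasSubgaussianMGF (ξ t) (Real.toNNReal (σ ^ 2)) P) :
    ENNReal.ofReal (1 - δ) ≤ P {ω | ∀ j, NoiseSmall R φ γ σ δ κ μ (fun t => ξ t ω) j} := by
  have : IsProbabilityMeasure P := hind.isProbabilityMeasure
  have hae : ∀ t, AEMeasurable (ξ t) P := fun t => (hsub t).aemeasurable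
  -- Sub-Gaussianity gives only almost everywhere measurability, so the noise is replaced by
  -- measurable versions.
  set ξ' : ℕ → Ω → ℝ := fun t => (hae t).mk (ξ t) with hξ'
  have heq : ∀ t, ξ t =ᵐ[P] ξ' t := fun t => (hae t).ae_eq_mk
  have hall : ∀ᵐ ω ∂P, ∀ t, ξ t ω = ξ' t ω := ae_all_iff.2 heq
  have hbad : P (⋃ j, {ω | ¬ NoiseSmall R φ γ σ δ κ μ (fun t => ξ' t ω) j}) ≤ ENNReal.ofReal δ := by
    refine (measure_iUnion_le _).trans ((ENNReal.tsum_le_tsum fun j => ?_).trans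
      (tsum_delta_le hδ0))
    exact measure_not_noiseSmall_le μ hγ hδ0 hδ1 hR (hind.congr heq)
      (fun t => (hae t).measurable_mk) (fun t => (hsub t).congr (heq t)) j
  set G := {ω | ∀ j, NoiseSmall R φ γ σ δ κ μ (fun t => ξ' t ω) j} with hG
  have hGG : P G ≤ P {ω | ∀ j, NoiseSmall R φ γ σ δ κ μ (fun t => ξ t ω) j} := by
    refine measure_mono_ae (hall.mono fun ω hω hmem => ?_)
    have : (fun t => ξ' t ω) = fun t => ξ t ω := funext fun t => (hω t).symm
    intro j
    rw [← this]
    exact hmem j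
  refine le_trans ?_ hGG
  -- Subadditivity on a cover bounds `P G` from below without needing `G` to be measurable.
  have hcover : (Set.univ : Set Ω) ⊆
      (⋃ j, {ω | ¬ NoiseSmall R φ γ σ δ κ μ (fun t => ξ' t ω) j}) ∪ G := by
    intro ω _
    by_cases h : ∀ j, NoiseSmall R φ γ σ δ κ μ (fun t => ξ' t ω) j
    · exact Or.inr h
    · push Not at h
      exact Or.inl (Set.mem_iUnion.2 h)
  have h1 : 1 ≤ ENNReal.ofReal δ + P G := by
    calc (1 : ENNReal) = P Set.univ := measure_univ.symm
      _ ≤ _ := (measure_mono hcover).trans (measure_union_le _ _)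
      _ ≤ _ := by gcongr
  rw [ENNReal.ofReal_sub _ hδ0.le, ENNReal.ofReal_one]
  exact tsub_le_iff_left.2 h1

end GoodEvent

end PTRBandit

end

/-! ### The effective dimension along a run, and the theorem. -/

noncomputable section

namespace PTRBandit

section MaxEffDim

variable {α : Type*} [Fintype α] {H : Type*} [NormedAddCommGroup H] [InnerProductSpace ℝ H]
  {φ : α → H} {γ : ℝ}

theorem effDim_le_maxEffDim (hγ : 0 < γ) {V : Finset α} (hV : V.Nonempty) {lam : α → ℝ}
    (hlam : lam ∈ simplex V) : effDim φ γ lam ≤ maxEffDim φ γ := by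
  have hinner : ∀ W : Finset α,
      BddAbove (Set.range fun lam : simplex W => effDim φ γ (lam : α → ℝ)) := fun W =>
    ⟨Fintype.card α, by rintro _ ⟨lam, rfl⟩; exact effDim_le_card φ γ hγ⟩
  have houter : BddAbove (Set.range fun W : {W : Finset α // W.Nonempty} =>
      ⨆ lam : simplex (W : Finset α), effDim φ γ (lam : α → ℝ)) := Set.finite_range _ |>.bddAbove
  exact (le_ciSup (hinner V) ⟨lam, hlam⟩).trans (le_ciSup houter ⟨V, hV⟩)

theorem runEffDim_le_maxEffDim (hγ : 0 < γ) {R : Rule α} {σ δ κ : ℝ}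
    (hR : R.IsPTR φ γ σ δ κ) (μ : α → ℝ) (ξ : ℕ → ℝ) (T : ℕ) :
    runEffDim R φ γ σ δ κ μ ξ T ≤ maxEffDim φ γ := by
  refine Finset.sup_le fun t _ => ?_
  dsimp only
  split_ifs with hcard
  · exact effDim_le_maxEffDim hγ (Finset.card_pos.1 (by omega)) (hR.design_mem _ hcard)
  · exact Nat.zero_le _

end MaxEffDim

end PTRBandit

end

theorem mainTheorem7 :
    ∃ κ₀ : ℝ, 1 ≤ κ₀ ∧ ∀ κ : ℝ, κ₀ ≤ κ → ∃ c : ℝ, 0 < c ∧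
      ∀ (α : Type*) [Fintype α] [Nonempty α]
        (H : Type*) [NormedAddCommGroup H] [InnerProductSpace ℝ H] [CompleteSpace H]
        (φ : α → H) (γ σ δ : ℝ), 0 < γ → 0 ≤ σ → 0 < δ → δ < 1 →
        (∃ R : PTRBandit.Rule α, R.IsPTR φ γ σ δ κ) ∧
        ∀ R : PTRBandit.Rule α, R.IsPTR φ γ σ δ κ →
        ∀ (μ : α → ℝ) (θ : H) (h B : ℝ), 0 ≤ h →
          (∀ x, |μ x - inner ℝ θ (φ x)| ≤ h) →
          (∀ x, |μ x| ≤ B) →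
          (h = 0 ∨ ∃ x, γ ≤ ‖φ x‖ ^ 2) →
        ∀ (Ω : Type*) [MeasurableSpace Ω] (P : MeasureTheory.Measure Ω)
          [MeasureTheory.IsProbabilityMeasure P] (ξ : ℕ → Ω → ℝ),
          ProbabilityTheory.iIndepFun ξ P →
          (∀ t, ∫ ω, ξ t ω ∂P = 0) →
          (∀ t, ProbabilityTheory.HasSubgaussianMGF (ξ t) (Real.toNNReal (σ ^ 2)) P) →
        ∀ T : ℕ, 2 ≤ T →
          (∀ ω, PTRBandit.runEffDim R φ γ σ δ κ μ (fun t => ξ t ω) T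
              ≤ PTRBandit.maxEffDim φ γ) ∧
          ENNReal.ofReal (1 - δ) ≤
            P {ω | PTRBandit.regret R φ γ σ δ κ μ (fun t => ξ t ω) T ≤
              c * max 1 B *
                ((PTRBandit.runEffDim R φ γ σ δ κ μ (fun t => ξ t ω) T : ℝ) +
                  Real.sqrt (PTRBandit.maxOptValue φ γ) *
                    (T * (Real.sqrt γ * ‖θ‖ + h) +
                      Real.sqrt (σ ^ 2 *
                        Real.log (Fintype.card α * Real.log T / δ) * T)))} := by
  -- `64` is the ratio of `τ` to the effective dimension that the rounding needs; `κ + 40` dominates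
  -- the coefficients `2`, `κ + 3` and `37` of the three regret terms.
  refine ⟨64, by norm_num, fun κ hκ => ⟨32 * (κ + 40), by linarith, ?_⟩⟩
  intro α _ _ H _ _ _ φ γ σ δ hγ _ hδ0 hδ1
  refine ⟨PTRBandit.exists_isPTR φ hγ hκ, ?_⟩
  intro R hR μ θ h B hh hμ hB hcase Ω _ P _ ξ hind _ hsub T hT
  refine ⟨fun ω => PTRBandit.runEffDim_le_maxEffDim hγ hR μ _ T, ?_⟩
  refine (PTRBandit.ofReal_le_measure_noiseSmall μ hγ hδ0 hδ1 hR hind hsub).trans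
    (MeasureTheory.measure_mono fun ω hω => ?_)
  exact PTRBandit.regret_le hγ hδ0 hδ1 (by linarith) hR hh hμ hB hcase hω hT
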